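/- All graphs are finite, undirected, without loops or multiple edges. A graph is edge-regular with parameters $(v,k,\lambda)$ if it has at least one edge, has $v$ vertices, is $k$-regular, and any two adjacent vertices have exactly $\lambda$ common neighbours. A graph is strongly regular if it is edge-regular and not complete, and any two distinct non-adjacent vertices have the same number $\mu$ of common neighbours. For $m\ge 1$, a clique $S$ is $m$-regular if every vertex outside $S$ is adjacent to exactly $m$ vertices of $S$; it is regular if it is $m$-regular for some $m \geq 1$. A Neumaier graph is a non-complete edge-regular graph containing a regular clique, and a strictly Neumaier graph is a Neumaier graph that is not strongly regular. For $s\ge 2$, $NG(v,k,\lambda;m,s)$ denotes the class of Neumaier graphs that are edge-regular with parameters $(v,k,\lambda)$ and contain an $m$-regular clique of size $s$; a graph in this class is said to have parameters $(v,k,\lambda;m,s)$. Then: 1. Up to isomorphism there is exactly one strictly Neumaier graph in $NG(16,9,4;2,4)$. 2. There is no strictly Neumaier graph in $NG(21,14,9;4,7)$ and none in $NG(22,12,5;2,4)$. 3. Every strictly Neumaier graph on at most $24$ vertices belongs to $NG(16,9,4;2,4)$ or to $NG(24,8,2;1,4)$. Moreover, if such a graph belongs to $NG(v,k,\lambda;m,s)$,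 then $(v,k,\lambda;m,s)$ is $(16,9,4;2,4)$ or $(24,8,2;1,4)$. -/

import Mathlib

universe u

namespace SimpleGraph

/-- A finite graph is edge-regular with parameters `(n, k, ℓ)` if it has at least one edge, has `n`
vertices, is `k`-regular, and any two adjacent vertices have exactly `ℓ` common neighbours. -/
structure IsEdgeRegularWith {V : Type*} [Fintype V] [DecidableEq V] (G : SimpleGraph V)
    [DecidableRel G.Adj] (n k ℓ : ℕ) : Prop where
  nonempty : G ≠ ⊥
  card : Fintype.card V = n
  regular : G.IsRegularOfDegree k
  of_adj : ∀ x y : V, G.Adj x y → Fintype.card (G.commonNeighbors x y) = ℓ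

/-- A finite graph is strongly regular if it has at least one edge, is not complete, is regular,
and the number of common neighbours of two distinct vertices depends only on whether they are
adjacent. (Mathlib's `IsSRGWith` allows graphs without edges and complete graphs.) -/
def IsStronglyRegular {V : Type*} [Fintype V] [DecidableEq V] (G : SimpleGraph V)
    [DecidableRel G.Adj] : Prop :=
  G ≠ ⊥ ∧ G ≠ ⊤ ∧ ∃ n k ℓ μ : ℕ, G.IsSRGWith n k ℓ μ

/-- `S` is an `m`-regular clique: a clique such that every vertex outside `S` is adjacent to exactly
`m` vertices of `S`, where `m` is positive. -/
structure IsRegularClique {V : Type*} (G : SimpleGraph V) [DecidableRel G.Adj]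
    (m : ℕ) (S : Finset V) : Prop where
  clique : G.IsClique (S : Set V)
  pos : 0 < m
  nexus : ∀ x : V, x ∉ S → (S.filter fun y => G.Adj x y).card = m

/-- A Neumaier graph: a non-complete edge-regular graph that contains a regular clique. -/
structure IsNeumaier {V : Type*} [Fintype V] [DecidableEq V] (G : SimpleGraph V)
    [DecidableRel G.Adj] : Prop where
  not_complete : G ≠ ⊤
  edgeRegular : ∃ n k ℓ : ℕ, G.IsEdgeRegularWith n k ℓ
  exists_clique : ∃ (m : ℕ) (S : Finset V), G.IsRegularClique m S

/-- Membership in `NG(n, k, ℓ; m, s)`: a non-complete edge-regular graph with parameters `(n, k, ℓ)`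
that contains an `m`-regular clique of size `s`, where `s ≥ 2`. -/
structure IsNeumaierWith {V : Type*} [Fintype V] [DecidableEq V] (G : SimpleGraph V)
    [DecidableRel G.Adj] (n k ℓ m s : ℕ) : Prop where
  not_complete : G ≠ ⊤
  edgeRegular : G.IsEdgeRegularWith n k ℓ
  two_le : 2 ≤ s
  exists_clique : ∃ S : Finset V, S.card = s ∧ G.IsRegularClique m S

/-- A strictly Neumaier graph: a Neumaier graph that is not strongly regular. -/
def IsStrictlyNeumaier {V : Type*} [Fintype V] [DecidableEq V] (G : SimpleGraph V)
    [DecidableRel G.Adj] : Prop :=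
  G.IsNeumaier ∧ ¬ G.IsStronglyRegular

end SimpleGraph

/-! Let `S` be an `m`-regular clique of size `s`. Write `o` for the number of vertices outside `S`,
`p` for the number of outside neighbours of a clique vertex, `t` for the number of outside common
neighbours of two clique vertices, and `r` for that of a clique vertex and an outside vertex
adjacent to it. The trace of an outside vertex is its set of neighbours in `S`. Counting edges and
paths of length two between `S` and its complement gives `s p = o m` and `s (p + (s - 1) t) = o m²`,
so `s`, `o`, `m` determine all parameters.

Together with `2 ∣ n k`, `3 ∣ n k ℓ`, `r < p` and `2 k < n + ℓ` (equality would make the graph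
complete multipartite), a finite check up to 24 vertices leaves two families and ten sporadic tuples
(`regularClique_parameters`). Both families are strongly regular: with `s = 3`, `m = 1` the
triangles form a generalized quadrangle, and with `m = 2`, `t = 1`, `p + 1 = s` the graph has the
parameters of a triangular graph. The tuple with `n = 16`, `k = 6` is also strongly regular, as a
lattice graph.

Five further tuples, including `(21,14,9;4,7)`, fall to a quadratic count
(`trace_quadratic_nonneg`): for an outside vertex `x`, a sum of products of consecutive integers,
formed from the sizes of the intersections of the trace of `x` with other traces, would be negative.
For `(15,10,6;3,5)` the same sum is zero, which fixes the intersection sizes so tightly that a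
parity contradiction follows.

There remain `(16,9,4;2,4)`, `(22,12,5;2,4)` and `(24,8,2;1,4)`. In the first two the traces are the
six pairs in a 4-set, each occurring `t` times, so the vertices can be labelled with all adjacencies
to the clique known. A verified backtracking search over rows of the adjacency matrix then settles
them. On 16 vertices every solution either has constant `μ = 6` or is a relabelling of
`neumaierGraph`. On 22 vertices the adjacencies between complementary traces are first shown to
follow one of two patterns, which leaves four searches, none with a solution. -/

open Finset

/-! ### Double counting in edge-regular graphs. -/

namespace SimpleGraph

section Counting

variable {V : Type*} [Fintype V] [DecidableEq V] {G : SimpleGraph V} [DecidableRel G.Adj]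
  {n k ℓ m s : ℕ} {S : Finset V}

/-- Double counting of the paths of length two with ends in `B` and `C` and centre in `A`. -/
theorem sum_card_inter_mul_card_inter (A B C : Finset V) :
    ∑ w ∈ A, #(G.neighborFinset w ∩ B) * #(G.neighborFinset w ∩ C) =
      ∑ b ∈ B, ∑ c ∈ C, #(G.neighborFinset b ∩ G.neighborFinset c ∩ A) := by
  have h1 : ∀ w (X : Finset V), #(G.neighborFinset w ∩ X) = ∑ x ∈ X, if G.Adj w x then 1 else 0 := by
    intro w X
    rw [Finset.sum_boole, Nat.cast_id]
    congr 1
    ext x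
    simp [and_comm]
  have h2 : ∀ b c, #(G.neighborFinset b ∩ G.neighborFinset c ∩ A) =
      ∑ w ∈ A, if G.Adj w b ∧ G.Adj w c then 1 else 0 := by
    intro b c
    rw [Finset.sum_boole, Nat.cast_id]
    congr 1
    ext x
    simp only [mem_inter, mem_neighborFinset, mem_filter, G.adj_comm]; tauto
  simp only [h1, h2, Finset.sum_mul_sum]
  rw [Finset.sum_comm]
  refine Finset.sum_congr rfl fun b _ => ?_
  rw [Finset.sum_comm]
  refine Finset.sum_congr rfl fun c _ => Finset.sum_congr rfl fun w _ => ?_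
  by_cases hb : G.Adj w b <;> by_cases hc : G.Adj w c <;> simp [hb, hc]

/-- Double counting of the edges between `A` and `B`. -/
theorem sum_card_inter_comm (A B : Finset V) :
    ∑ a ∈ A, #(G.neighborFinset a ∩ B) = ∑ b ∈ B, #(G.neighborFinset b ∩ A) := by
  have h1 : ∀ w (X : Finset V), #(G.neighborFinset w ∩ X) = ∑ x ∈ X, if G.Adj w x then 1 else 0 := by
    intro w X
    rw [Finset.sum_boole, Nat.cast_id]
    congr 1
    ext x
    simp [and_comm]
  simp only [h1]
  rw [Finset.sum_comm]
  simp only [G.adj_comm]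

theorem card_commonNeighbors_eq (x y : V) :
    Fintype.card (G.commonNeighbors x y) = #(G.neighborFinset x ∩ G.neighborFinset y) := by
  rw [← Set.toFinset_card]
  congr 1
  ext z
  simp [mem_commonNeighbors]

namespace IsEdgeRegularWith

variable (hG : G.IsEdgeRegularWith n k ℓ)
include hG

theorem card_nbr (x : V) : #(G.neighborFinset x) = k := hG.regular x

theorem card_common {x y : V} (h : G.Adj x y) :
    #(G.neighborFinset x ∩ G.neighborFinset y) = ℓ := by
  rw [← card_commonNeighbors_eq, hG.of_adj x y h]

theorem exists_adj : ∃ x y, G.Adj x y := by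
  by_contra! h
  exact hG.nonempty (by ext x y; simp [h x y])

theorem isStronglyRegular (hne : G ≠ ⊤) (μ : ℕ)
    (h : ∀ x y, x ≠ y → ¬ G.Adj x y → #(G.neighborFinset x ∩ G.neighborFinset y) = μ) :
    G.IsStronglyRegular := by
  refine ⟨hG.nonempty, hne, n, k, ℓ, μ, ?_⟩
  refine ⟨hG.card, hG.regular, hG.of_adj, ?_⟩
  intro x y hxy hadj
  rw [card_commonNeighbors_eq]
  exact h x y hxy hadj

theorem two_dvd : 2 ∣ n * k := by
  have h := G.sum_degrees_eq_twice_card_edges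
  rw [Finset.sum_congr rfl fun x _ => hG.regular x] at h
  simp only [sum_const, card_univ, hG.card, smul_eq_mul] at h
  exact ⟨_, h⟩

/-- The neighbourhoods of two adjacent vertices have a union of size `2 k - ℓ`. -/
theorem two_mul_le : 2 * k ≤ n + ℓ := by
  obtain ⟨x, y, h⟩ := hG.exists_adj
  have h1 := Finset.card_union_add_card_inter (G.neighborFinset x) (G.neighborFinset y)
  rw [hG.card_common h, hG.card_nbr, hG.card_nbr] at h1
  have h2 : #(G.neighborFinset x ∪ G.neighborFinset y) ≤ n := by
    rw [← hG.card]; exact Finset.card_le_univ _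
  omega

/-- There are `n k ℓ` ordered triangles, and rotating them is an action of order three without fixed
points. -/
theorem three_dvd : 3 ∣ n * k * ℓ := by
  let T := {q : V × V × V // G.Adj q.1 q.2.1 ∧ G.Adj q.2.1 q.2.2 ∧ G.Adj q.2.2 q.1}
  let f : Function.End T := fun q => ⟨(q.1.2.1, q.1.2.2, q.1.1), q.2.2.1, q.2.2.2, q.2.1⟩
  -- The exponent is written as a prime power, as the fixed point congruence expects.
  have hf : f ^ 3 ^ 1 = 1 := by
    funext q
    rfl
  have : Fact (Nat.Prime 3) := ⟨Nat.prime_three⟩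
  have h := Equiv.Perm.card_fixedPoints_modEq hf
  have h0 : Fintype.card (Function.fixedPoints f) = 0 := by
    rw [Fintype.card_eq_zero_iff]
    refine ⟨fun q => ?_⟩
    have h1 := congrArg (fun q : T => q.1.1) q.2
    have h2 := q.1.2.1
    exact G.ne_of_adj h2 h1.symm
  rw [h0] at h
  have hc : Fintype.card T = n * k * ℓ := by
    have : Fintype.card T = #(univ.filter fun q : V × V × V =>
        G.Adj q.1 q.2.1 ∧ G.Adj q.2.1 q.2.2 ∧ G.Adj q.2.2 q.1) := Fintype.card_subtype _
    rw [this, Finset.card_filter, Fintype.sum_prod_type]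
    have inner : ∀ x, (∑ q : V × V, if G.Adj x q.1 ∧ G.Adj q.1 q.2 ∧ G.Adj q.2 x then 1 else 0)
        = k * ℓ := by
      intro x
      rw [Fintype.sum_prod_type]
      have : ∀ y, (∑ z, if G.Adj x y ∧ G.Adj y z ∧ G.Adj z x then 1 else 0)
          = if y ∈ G.neighborFinset x then ℓ else 0 := by
        intro y
        by_cases hxy : G.Adj x y
        · rw [if_pos (by simpa using hxy), ← hG.card_common hxy, ← Finset.card_filter]
          congr 1
          ext z
          simp [hxy, G.adj_comm, and_comm]
        · simp [hxy]
      rw [Finset.sum_congr rfl fun y _ => this y, Finset.sum_ite_mem, univ_inter, sum_const,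
        hG.card_nbr, smul_eq_mul]
    rw [Finset.sum_congr rfl fun x _ => inner x, sum_const, card_univ, hG.card, smul_eq_mul,
      mul_assoc]
  rw [hc] at h
  exact (Nat.modEq_zero_iff_dvd.1 h)

/-- If every vertex is adjacent to an end of every edge, the graph is complete multipartite. -/
theorem isStronglyRegular_of_two_mul_eq (hne : G ≠ ⊤) (h : 2 * k = n + ℓ) :
    G.IsStronglyRegular := by
  refine hG.isStronglyRegular hne k fun x z _ hxz => ?_
  have key : G.neighborFinset x ⊆ G.neighborFinset z := by
    intro w hw
    have hw : G.Adj x w := by simpa using hw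
    have h1 := Finset.card_union_add_card_inter (G.neighborFinset x) (G.neighborFinset w)
    rw [hG.card_common hw, hG.card_nbr, hG.card_nbr] at h1
    have h2 : G.neighborFinset x ∪ G.neighborFinset w = univ := by
      apply Finset.eq_univ_of_card
      rw [hG.card]; omega
    have h3 : z ∈ G.neighborFinset x ∪ G.neighborFinset w := by rw [h2]; exact mem_univ _
    rw [Finset.mem_union, mem_neighborFinset, mem_neighborFinset] at h3
    rcases h3 with h3 | h3
    · exact absurd h3 hxz
    · simpa using h3.symm
  rw [Finset.inter_eq_left.2 key, hG.card_nbr]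

end IsEdgeRegularWith

end Counting

end SimpleGraph

/-! ### Counting identities for a regular clique. -/

namespace SimpleGraph

section RegularClique

variable {V : Type*} [Fintype V] [DecidableEq V] {G : SimpleGraph V} [DecidableRel G.Adj]
  {n k ℓ m s p t r o : ℕ} {S : Finset V}

omit [Fintype V] [DecidableEq V] in
theorem adj_of_mem_clique (hS : G.IsRegularClique m S) {x y : V} (hx : x ∈ S) (hy : y ∈ S)
    (h : x ≠ y) : G.Adj x y :=
  hS.clique (Finset.mem_coe.2 hx) (Finset.mem_coe.2 hy) h

theorem card_nexus (hS : G.IsRegularClique m S) {x : V} (hx : x ∉ S) :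
    #(G.neighborFinset x ∩ S) = m := by
  rw [← hS.nexus x hx]
  congr 1
  ext z
  simp [and_comm]

theorem neighborFinset_inter_clique (hS : G.IsRegularClique m S) {y : V} (hy : y ∈ S) :
    G.neighborFinset y ∩ S = S.erase y := by
  ext z
  simp only [mem_inter, mem_neighborFinset, mem_erase]
  exact ⟨fun h => ⟨(G.ne_of_adj h.1).symm, h.2⟩,
    fun h => ⟨adj_of_mem_clique hS hy h.2 (Ne.symm h.1), h.2⟩⟩

theorem card_inter_add_card_inter_compl (A S : Finset V) : #(A ∩ S) + #(A ∩ Sᶜ) = #A := by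
  rw [← Finset.card_union_of_disjoint]
  · rw [← Finset.inter_union_distrib_left, Finset.union_compl, Finset.inter_univ]
  · exact Finset.disjoint_left.2 fun a h1 h2 => by simp_all

theorem card_nbr_compl (hG : G.IsEdgeRegularWith n k ℓ) (hS : G.IsRegularClique m S)
    (hp : p + #S = k + 1) {y : V} (hy : y ∈ S) : #(G.neighborFinset y ∩ Sᶜ) = p := by
  have h := card_inter_add_card_inter_compl (G.neighborFinset y) S
  rw [neighborFinset_inter_clique hS hy, hG.card_nbr, Finset.card_erase_of_mem hy] at h
  have := Finset.card_pos.2 ⟨y, hy⟩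
  omega

theorem card_common_compl (hG : G.IsEdgeRegularWith n k ℓ) (hS : G.IsRegularClique m S)
    (ht : t + #S = ℓ + 2) {y z : V} (hy : y ∈ S) (hz : z ∈ S) (hyz : y ≠ z) :
    #(G.neighborFinset y ∩ G.neighborFinset z ∩ Sᶜ) = t := by
  have h := card_inter_add_card_inter_compl (G.neighborFinset y ∩ G.neighborFinset z) S
  rw [Finset.inter_assoc, neighborFinset_inter_clique hS hz, Finset.inter_erase,
    neighborFinset_inter_clique hS hy, hG.card_common (adj_of_mem_clique hS hy hz hyz),
    Finset.card_erase_of_mem (Finset.mem_erase.2 ⟨hyz.symm, hz⟩), Finset.card_erase_of_mem hy] at h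
  have : #({y, z} : Finset V) ≤ #S := Finset.card_le_card (by
    intro a ha
    rcases Finset.mem_insert.1 ha with rfl | ha
    · exact hy
    · rw [Finset.mem_singleton.1 ha]; exact hz)
  rw [Finset.card_pair hyz] at this
  omega

theorem card_common_compl_of_notMem (hG : G.IsEdgeRegularWith n k ℓ)
    (hS : G.IsRegularClique m S) (hr : r + m = ℓ + 1) {x y : V} (hx : x ∉ S) (hy : y ∈ S)
    (hxy : G.Adj x y) : #(G.neighborFinset x ∩ G.neighborFinset y ∩ Sᶜ) = r := by
  have h := card_inter_add_card_inter_compl (G.neighborFinset x ∩ G.neighborFinset y) S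
  rw [Finset.inter_assoc, neighborFinset_inter_clique hS hy, Finset.inter_erase,
    hG.card_common hxy, Finset.card_erase_of_mem (by simp [hxy, hy]), card_nexus hS hx] at h
  have := hS.pos
  omega

theorem exists_notMem_clique (hne : G ≠ ⊤) (hS : G.IsRegularClique m S) : ∃ x, x ∉ S := by
  by_contra! h
  refine hne ?_
  ext x y
  rw [top_adj]
  exact ⟨G.ne_of_adj, adj_of_mem_clique hS (h x) (h y)⟩

theorem exists_adj_clique (hS : G.IsRegularClique m S) {x : V} (hx : x ∉ S) :
    ∃ y ∈ S, G.Adj x y := by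
  have h : 0 < #(G.neighborFinset x ∩ S) := by rw [card_nexus hS hx]; exact hS.pos
  obtain ⟨y, hy⟩ := Finset.card_pos.1 h
  exact ⟨y, (Finset.mem_inter.1 hy).2, by simpa using (Finset.mem_inter.1 hy).1⟩

theorem lt_of_ne_top (hG : G.IsEdgeRegularWith n k ℓ) (hne : G ≠ ⊤) : k + 1 < n := by
  by_contra! hk
  refine hne ?_
  ext x y
  rw [top_adj]
  refine ⟨G.ne_of_adj, fun hxy => ?_⟩
  have h1 : #(insert x (G.neighborFinset x)) = k + 1 := by
    rw [Finset.card_insert_of_notMem (by simp), hG.card_nbr]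
  have h2 : insert x (G.neighborFinset x) = univ := by
    apply Finset.eq_univ_of_card
    have := Finset.card_le_univ (insert x (G.neighborFinset x))
    rw [hG.card] at *
    omega
  have h3 : y ∈ insert x (G.neighborFinset x) := by rw [h2]; exact mem_univ _
  rw [Finset.mem_insert, mem_neighborFinset] at h3
  exact h3.resolve_left (Ne.symm hxy)

/-- Otherwise every outside vertex is joined to all of `S`, so a clique vertex is adjacent to every
other vertex; by regularity the graph is then complete. -/
theorem nexus_lt_card (hG : G.IsEdgeRegularWith n k ℓ) (hne : G ≠ ⊤)
    (hS : G.IsRegularClique m S) : m < #S := by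
  obtain ⟨x, hx⟩ := exists_notMem_clique hne hS
  obtain ⟨y, hy, -⟩ := exists_adj_clique hS hx
  by_contra! h
  have h1 : ∀ z, z ∉ S → G.Adj y z := by
    intro z hz
    have h2 : G.neighborFinset z ∩ S = S :=
      Finset.eq_of_subset_of_card_le Finset.inter_subset_right (by rw [card_nexus hS hz]; exact h)
    have h3 : y ∈ G.neighborFinset z ∩ S := by rw [h2]; exact hy
    rw [Finset.mem_inter, mem_neighborFinset] at h3
    exact h3.1.symm
  have h4 : insert y (G.neighborFinset y) = univ := by
    ext z
    simp only [mem_insert, mem_neighborFinset, mem_univ, iff_true]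
    by_cases hz : z ∈ S
    · by_cases hyz : z = y
      · exact Or.inl hyz
      · exact Or.inr (adj_of_mem_clique hS hy hz (Ne.symm hyz))
    · exact Or.inr (h1 z hz)
  have h5 := congrArg Finset.card h4
  rw [Finset.card_insert_of_notMem (by simp), hG.card_nbr, card_univ, hG.card] at h5
  have := lt_of_ne_top hG hne
  omega

theorem card_compl_clique (hG : G.IsEdgeRegularWith n k ℓ) (ho : o + #S = n) : #Sᶜ = o := by
  rw [Finset.card_compl, hG.card]; omega

/-- Counting the edges between the outside vertices and a part of the clique. -/
theorem sum_card_inter_part (hG : G.IsEdgeRegularWith n k ℓ) (hS : G.IsRegularClique m S)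
    (hp : p + #S = k + 1) {B : Finset V} (hB : B ⊆ S) :
    ∑ w ∈ Sᶜ, #(G.neighborFinset w ∩ B) = #B * p := by
  rw [sum_card_inter_comm, Finset.sum_congr rfl fun b hb => card_nbr_compl hG hS hp (hB hb),
    Finset.sum_const, smul_eq_mul]

theorem sum_card_inter_sq (hG : G.IsEdgeRegularWith n k ℓ) (hS : G.IsRegularClique m S)
    (hp : p + #S = k + 1) (ht : t + #S = ℓ + 2) {B : Finset V} (hB : B ⊆ S) :
    ∑ w ∈ Sᶜ, #(G.neighborFinset w ∩ B) * #(G.neighborFinset w ∩ B) =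
      #B * (p + (#B - 1) * t) := by
  rw [sum_card_inter_mul_card_inter]
  have : ∀ b ∈ B, ∑ c ∈ B, #(G.neighborFinset b ∩ G.neighborFinset c ∩ Sᶜ) =
      p + (#B - 1) * t := by
    intro b hb
    rw [← Finset.add_sum_erase _ _ hb, Finset.inter_self, card_nbr_compl hG hS hp (hB hb),
      Finset.sum_congr rfl fun c hc => card_common_compl hG hS ht (hB hb)
        (hB (Finset.mem_of_mem_erase hc)) (Finset.ne_of_mem_erase hc).symm,
      Finset.sum_const, Finset.card_erase_of_mem hb, smul_eq_mul]
  rw [Finset.sum_congr rfl this, Finset.sum_const, smul_eq_mul]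

theorem sum_card_inter_mul_disjoint (hG : G.IsEdgeRegularWith n k ℓ)
    (hS : G.IsRegularClique m S) (ht : t + #S = ℓ + 2) {B C : Finset V} (hB : B ⊆ S)
    (hC : C ⊆ S) (hBC : Disjoint B C) :
    ∑ w ∈ Sᶜ, #(G.neighborFinset w ∩ B) * #(G.neighborFinset w ∩ C) = #B * #C * t := by
  rw [sum_card_inter_mul_card_inter]
  have : ∀ b ∈ B, ∑ c ∈ C, #(G.neighborFinset b ∩ G.neighborFinset c ∩ Sᶜ) = #C * t := by
    intro b hb
    rw [Finset.sum_congr rfl fun c hc => card_common_compl hG hS ht (hB hb) (hC hc)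
        (fun h => Finset.disjoint_left.1 hBC hb (h ▸ hc)), Finset.sum_const, smul_eq_mul]
  rw [Finset.sum_congr rfl this, Finset.sum_const, smul_eq_mul, mul_assoc]

theorem clique_mul_eq (hG : G.IsEdgeRegularWith n k ℓ) (hS : G.IsRegularClique m S)
    (hp : p + #S = k + 1) (ho : o + #S = n) : #S * p = o * m := by
  rw [← sum_card_inter_part hG hS hp subset_rfl,
    Finset.sum_congr rfl fun w hw => card_nexus hS (Finset.mem_compl.1 hw), Finset.sum_const,
    card_compl_clique hG ho, smul_eq_mul]

/-- Ordered pairs of clique vertices are counted with their common outside neighbours: equal pairs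
contribute `p`, distinct ones `t`, and each outside vertex is counted `m²` times. -/
theorem clique_mul_mul_eq (hG : G.IsEdgeRegularWith n k ℓ) (hS : G.IsRegularClique m S)
    (hp : p + #S = k + 1) (ho : o + #S = n) (ht : t + #S = ℓ + 2) :
    #S * (p + (#S - 1) * t) = o * (m * m) := by
  rw [← sum_card_inter_sq hG hS hp ht subset_rfl,
    Finset.sum_congr rfl fun w hw => by rw [card_nexus hS (Finset.mem_compl.1 hw)],
    Finset.sum_const, card_compl_clique hG ho, smul_eq_mul]

/-- For an outside vertex `x` adjacent to `y ∈ S`, the outside neighbours of `y` include `x` itself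
besides the `r` common ones. -/
theorem local_lt (hG : G.IsEdgeRegularWith n k ℓ) (hne : G ≠ ⊤) (hS : G.IsRegularClique m S)
    (hp : p + #S = k + 1) (hr : r + m = ℓ + 1) : r < p := by
  obtain ⟨x, hx⟩ := exists_notMem_clique hne hS
  obtain ⟨y, hy, hxy⟩ := exists_adj_clique hS hx
  rw [← card_common_compl_of_notMem hG hS hr hx hy hxy, ← card_nbr_compl hG hS hp hy]
  apply Finset.card_lt_card
  refine ⟨fun a ha => ?_, fun h => ?_⟩
  · simp only [mem_inter] at ha ⊢
    exact ⟨ha.1.2, ha.2⟩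
  · have h1 := @h x (by simp [hx, hxy.symm])
    simp at h1

/-- The non-neighbours of `x` outside `S` other than `x`. -/
def outerNonNbrs (G : SimpleGraph V) [DecidableRel G.Adj] (S : Finset V) (x : V) : Finset V :=
  (Sᶜ \ G.neighborFinset x).erase x

theorem mem_outerNonNbrs {x w : V} :
    w ∈ outerNonNbrs G S x ↔ w ≠ x ∧ w ∉ S ∧ ¬ G.Adj x w := by
  simp [outerNonNbrs]

theorem sum_compl_split {M : Type*} [AddCommMonoid M] (f : V → M) {x : V} (hx : x ∉ S) :
    ∑ w ∈ Sᶜ, f w = ∑ w ∈ G.neighborFinset x ∩ Sᶜ, f w + ∑ w ∈ outerNonNbrs G S x, f w + f x := by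
  have hx' : x ∈ Sᶜ \ G.neighborFinset x := by simp [hx]
  rw [outerNonNbrs, add_assoc, Finset.sum_erase_add _ _ hx', Finset.inter_comm,
    Finset.sum_inter_add_sum_sdiff]

theorem card_nbr_inter_compl (hG : G.IsEdgeRegularWith n k ℓ) (hS : G.IsRegularClique m S)
    {x : V} (hx : x ∉ S) : #(G.neighborFinset x ∩ Sᶜ) + m = k := by
  have h := card_inter_add_card_inter_compl (G.neighborFinset x) S
  rw [card_nexus hS hx, hG.card_nbr] at h
  omega

theorem card_outerNonNbrs (hG : G.IsEdgeRegularWith n k ℓ) (hS : G.IsRegularClique m S)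
    (ho : o + #S = n) {x : V} (hx : x ∉ S) : #(outerNonNbrs G S x) + 1 + k = o + m := by
  have h := sum_compl_split (G := G) (S := S) (fun _ => 1) hx
  simp only [Finset.sum_const, mul_one, card_compl_clique hG ho, smul_eq_mul] at h
  have := card_nbr_inter_compl hG hS hx
  omega

theorem sum_trace_nbrs (hG : G.IsEdgeRegularWith n k ℓ) (hS : G.IsRegularClique m S)
    (hr : r + m = ℓ + 1) {x : V} (hx : x ∉ S) :
    ∑ w ∈ G.neighborFinset x ∩ Sᶜ, #(G.neighborFinset w ∩ (G.neighborFinset x ∩ S)) = m * r := by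
  have h1 : ∀ b ∈ G.neighborFinset x ∩ S,
      #(G.neighborFinset b ∩ (G.neighborFinset x ∩ Sᶜ)) = r := by
    intro b hb
    rw [Finset.mem_inter, mem_neighborFinset] at hb
    rw [← Finset.inter_assoc, Finset.inter_comm (G.neighborFinset b),
      card_common_compl_of_notMem hG hS hr hx hb.2 hb.1]
  rw [sum_card_inter_comm, Finset.sum_congr rfl h1, Finset.sum_const, card_nexus hS hx,
    smul_eq_mul]

/-- All outside vertices together meet the trace of `x` in `m p` incidences; the neighbours of `x`
account for `m r` of them and `x` itself for `m`. -/
theorem sum_trace_nonNbrs (hG : G.IsEdgeRegularWith n k ℓ) (hS : G.IsRegularClique m S)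
    (hp : p + #S = k + 1) (hr : r + m = ℓ + 1) {x : V} (hx : x ∉ S) :
    ∑ w ∈ outerNonNbrs G S x, #(G.neighborFinset w ∩ (G.neighborFinset x ∩ S)) + m * r + m =
      m * p := by
  have h := sum_card_inter_part hG hS hp
    (Finset.inter_subset_right : G.neighborFinset x ∩ S ⊆ S)
  rw [sum_compl_split (G := G) _ hx, sum_trace_nbrs hG hS hr hx, ← Finset.inter_assoc, Finset.inter_self,
    card_nexus hS hx] at h
  omega

/-- The distribution of the intersections of the traces on `S` of the outside vertices with the
trace of a fixed outside vertex. -/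
theorem sum_trace_quadratic (hG : G.IsEdgeRegularWith n k ℓ) (hS : G.IsRegularClique m S)
    (hp : p + #S = k + 1) (ho : o + #S = n) (ht : t + #S = ℓ + 2) (hr : r + m = ℓ + 1)
    {x : V} (hx : x ∉ S) {a : V → ℤ}
    (ha : ∀ w, a w = #(G.neighborFinset w ∩ (G.neighborFinset x ∩ S))) (q q' : ℤ) :
    ∑ w ∈ G.neighborFinset x ∩ Sᶜ, (a w - q) * (a w - q - 1) +
      ∑ w ∈ outerNonNbrs G S x, (a w - q') * (a w - q' - 1) =
    m * (p + (m - 1) * t) - m * m - (2 * q + 1) * (m * r) - (2 * q' + 1) * (m * p - m * r - m)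
      + q * (q + 1) * (k - m) + q' * (q' + 1) * (o - 1 - (k - m)) := by
  have hm := card_nexus hS hx
  have hpos := hS.pos
  have s2 : ∑ w ∈ Sᶜ, a w * a w = m * (p + (m - 1) * t) := by
    have := sum_card_inter_sq hG hS hp ht
      (Finset.inter_subset_right : G.neighborFinset x ∩ S ⊆ S)
    rw [hm] at this
    simp only [ha]
    have h1 : ((m - 1 : ℕ) : ℤ) = m - 1 := by push_cast [hpos]; ring
    rw [← h1]
    exact_mod_cast this
  have s3 : ∑ w ∈ G.neighborFinset x ∩ Sᶜ, a w = m * r := by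
    simp only [ha]
    exact_mod_cast sum_trace_nbrs hG hS hr hx
  have s4 : ∑ w ∈ outerNonNbrs G S x, a w = m * p - m * r - m := by
    have := sum_trace_nonNbrs hG hS hp hr hx
    zify at this
    simp only [ha]
    linarith
  have ax : a x = m := by
    rw [ha, ← Finset.inter_assoc, Finset.inter_self, hm]
  have c1 : (#(G.neighborFinset x ∩ Sᶜ) : ℤ) = k - m := by
    have := card_nbr_inter_compl hG hS hx
    omega
  have c2 : (#(outerNonNbrs G S x) : ℤ) = o - 1 - (k - m) := by
    have := card_outerNonNbrs hG hS ho hx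
    omega
  have e2 := sum_compl_split (G := G) (S := S) (fun w => a w * a w) hx
  -- The second moment is known only for all outside vertices together, but both quadratics have
  -- leading coefficient one, so only the total is needed.
  have expand : ∀ (A : Finset V) (q : ℤ), ∑ w ∈ A, (a w - q) * (a w - q - 1) =
      ∑ w ∈ A, a w * a w - (2 * q + 1) * ∑ w ∈ A, a w + q * (q + 1) * #A := by
    intro A q
    rw [Finset.mul_sum, ← Finset.sum_sub_distrib, mul_comm _ (#A : ℤ), ← nsmul_eq_mul,
      ← Finset.sum_const, ← Finset.sum_add_distrib]
    exact Finset.sum_congr rfl fun w _ => by ring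
  rw [expand, expand, c1, c2, s3, s4]
  simp only [ax, s2] at e2
  linarith

theorem consecutive_mul_nonneg (a : ℤ) : 0 ≤ a * (a - 1) := by
  rcases le_or_gt a 0 with h | h
  · nlinarith
  · nlinarith

/-- Products of consecutive integers are nonnegative. This bound sees integrality, so it is stronger
than the one from variances; it is sharpest with `q` and `q'` the integer parts of the mean
intersections. -/
theorem trace_quadratic_nonneg (hG : G.IsEdgeRegularWith n k ℓ) (hne : G ≠ ⊤)
    (hS : G.IsRegularClique m S)
    (hp : p + #S = k + 1) (ho : o + #S = n) (ht : t + #S = ℓ + 2) (hr : r + m = ℓ + 1)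
    (q q' : ℤ) :
    0 ≤ (m * (p + (m - 1) * t) - m * m - (2 * q + 1) * (m * r)
      - (2 * q' + 1) * (m * p - m * r - m)
      + q * (q + 1) * (k - m) + q' * (q' + 1) * (o - 1 - (k - m)) : ℤ) := by
  obtain ⟨x, hx⟩ := exists_notMem_clique hne hS
  rw [← sum_trace_quadratic hG hS hp ho ht hr hx (fun w => rfl) q q']
  exact add_nonneg (Finset.sum_nonneg fun w _ => consecutive_mul_nonneg _)
    (Finset.sum_nonneg fun w _ => consecutive_mul_nonneg _)

end RegularClique

end SimpleGraph

/-! ### Parameters that force strong regularity or are impossible. -/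

namespace SimpleGraph

section SmallCases

variable {V : Type*} [Fintype V] [DecidableEq V] {G : SimpleGraph V} [DecidableRel G.Adj]
  {n k ℓ m s p t r o : ℕ} {S : Finset V}

/-- If every edge is in a unique triangle and there are `3 (k - 1)` vertices, then the vertices and
triangles form a generalized quadrangle. -/
theorem isStronglyRegular_of_triangles (hG : G.IsEdgeRegularWith n k 1) (hne : G ≠ ⊤)
    (hn : n + 3 = 3 * k) : G.IsStronglyRegular := by
  have uniq : ∀ {a b z z'}, G.Adj a b → z ∈ G.neighborFinset a ∩ G.neighborFinset b →
      z' ∈ G.neighborFinset a ∩ G.neighborFinset b → z = z' := fun hab hz hz' =>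
    Finset.card_le_one.1 (hG.card_common hab).le _ hz _ hz'
  -- The three neighbourhoods meet pairwise in the third vertex of the triangle only, so their union
  -- has `3 k - 3 = n` elements.
  have cover : ∀ {a b c}, G.Adj a b → G.Adj b c → G.Adj c a → ∀ z,
      G.Adj a z ∨ G.Adj b z ∨ G.Adj c z := by
    intro a b c hab hbc hca z
    have h1 := Finset.card_union_add_card_inter (G.neighborFinset a) (G.neighborFinset b)
    have h2 := Finset.card_union_add_card_inter (G.neighborFinset a ∪ G.neighborFinset b)
      (G.neighborFinset c)
    have h3 : (G.neighborFinset a ∪ G.neighborFinset b) ∩ G.neighborFinset c ⊆ {a, b} := by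
      intro w hw
      simp only [mem_inter, mem_union, mem_neighborFinset] at hw
      rcases hw with ⟨hw | hw, hc⟩
      · have : w = b := uniq hca.symm (by simp [hw, hc]) (by simp [hab, hbc.symm])
        simp [this]
      · have : w = a := uniq hbc (by simp [hw, hc]) (by simp [hab.symm, hca])
        simp [this]
    have h4 := (Finset.card_le_card h3).trans Finset.card_le_two
    simp only [hG.card_common hab, hG.card_nbr] at h1 h2
    have h5 : (G.neighborFinset a ∪ G.neighborFinset b) ∪ G.neighborFinset c = univ := by
      apply Finset.eq_univ_of_card
      have := Finset.card_le_univ ((G.neighborFinset a ∪ G.neighborFinset b) ∪ G.neighborFinset c)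
      rw [hG.card] at *
      omega
    have h6 := Finset.mem_univ z
    rw [← h5] at h6
    simpa [or_assoc] using h6
  refine hG.isStronglyRegular hne (k / 2) fun x z hne' hxz => ?_
  -- The neighbours of `x` are paired off by the triangles at `x`. By `cover` and uniqueness of
  -- triangles, `z` is adjacent to exactly one of each pair, whence `μ = k / 2`.
  have e1 : ∀ w ∈ G.neighborFinset x ∩ G.neighborFinset z,
      #(G.neighborFinset w ∩ (G.neighborFinset x \ G.neighborFinset z)) = 1 := by
    intro w hw
    simp only [mem_inter, mem_neighborFinset] at hw
    rw [← hG.card_common hw.1.symm]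
    congr 1
    ext y
    simp only [mem_inter, mem_sdiff, mem_neighborFinset]
    refine ⟨fun h => ⟨h.1, h.2.1⟩, fun h => ⟨h.1, h.2, fun hzy => ?_⟩⟩
    have : x = z := uniq h.1 (by simp [hw.1.symm, h.2.symm]) (by simp [hw.2.symm, hzy.symm])
    exact hne' this
  have e2 : ∀ w ∈ G.neighborFinset x \ G.neighborFinset z,
      #(G.neighborFinset w ∩ (G.neighborFinset x ∩ G.neighborFinset z)) = 1 := by
    intro w hw
    simp only [mem_sdiff, mem_neighborFinset] at hw
    rw [← hG.card_common hw.1.symm]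
    congr 1
    ext y
    simp only [mem_inter, mem_neighborFinset]
    refine ⟨fun h => ⟨h.1, h.2.1⟩, fun h => ⟨h.1, h.2, ?_⟩⟩
    rcases cover hw.1 h.1 h.2.symm z with h' | h' | h'
    · exact absurd h' hxz
    · exact absurd h'.symm hw.2
    · exact h'.symm
  have h1 := sum_card_inter_comm (G := G) (G.neighborFinset x ∩ G.neighborFinset z)
    (G.neighborFinset x \ G.neighborFinset z)
  rw [Finset.sum_congr rfl e1, Finset.sum_congr rfl e2] at h1
  simp only [sum_const, smul_eq_mul, mul_one] at h1
  have h2 := Finset.card_inter_add_card_sdiff (G.neighborFinset x) (G.neighborFinset z)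
  rw [hG.card_nbr] at h2
  omega

/-- If the outside neighbours of a clique vertex induce a regular graph of the largest possible
degree, they are mutually adjacent. -/
theorem adj_of_common_nbr_clique (hG : G.IsEdgeRegularWith n k ℓ) (hS : G.IsRegularClique m S)
    (hp : p + #S = k + 1) (hr : r + m = ℓ + 1) (hrp : r + 1 = p) {x w y : V} (hx : x ∉ S)
    (hw : w ∉ S) (hxw : x ≠ w) (hy : y ∈ S) (hxy : G.Adj x y) (hwy : G.Adj w y) :
    G.Adj x w := by
  have h1 : G.neighborFinset x ∩ G.neighborFinset y ∩ Sᶜ = (G.neighborFinset y ∩ Sᶜ).erase x := by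
    apply Finset.eq_of_subset_of_card_le
    · intro a ha
      simp only [mem_inter, mem_neighborFinset, mem_erase] at ha ⊢
      exact ⟨(G.ne_of_adj ha.1.1).symm, ha.1.2, ha.2⟩
    · rw [card_common_compl_of_notMem hG hS hr hx hy hxy, Finset.card_erase_of_mem
        (by simp [hx, hxy.symm]), card_nbr_compl hG hS hp hy]
      omega
  have h2 : w ∈ (G.neighborFinset y ∩ Sᶜ).erase x := by simp [hw, hwy.symm, hxw.symm]
  rw [← h1] at h2
  simp only [mem_inter, mem_neighborFinset] at h2
  exact h2.1.1

/-- An outside vertex with two neighbours in `T` would give them a third common neighbour. As `T`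
sends `4 * 3` edges to `12` outside vertices, each receives exactly one. -/
theorem isRegularClique_of_card_four (hG : G.IsEdgeRegularWith 16 6 2) {T : Finset V}
    (hT : G.IsClique (T : Set V)) (hc : #T = 4) : G.IsRegularClique 1 T := by
  have hle : ∀ v ∈ Tᶜ, #(G.neighborFinset v ∩ T) ≤ 1 := by
    intro v hv
    rw [Finset.mem_compl] at hv
    by_contra! h
    obtain ⟨a, ha, b, hb, hab⟩ := Finset.one_lt_card.1 h
    simp only [mem_inter, mem_neighborFinset] at ha hb
    have h1 := hT (Finset.mem_coe.2 ha.2) (Finset.mem_coe.2 hb.2) hab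
    have h2 : insert v ((T.erase a).erase b) ⊆ G.neighborFinset a ∩ G.neighborFinset b := by
      intro z hz
      simp only [mem_insert, mem_erase, mem_inter, mem_neighborFinset] at hz ⊢
      rcases hz with rfl | ⟨hzb, hza, hz⟩
      · exact ⟨ha.1.symm, hb.1.symm⟩
      · exact ⟨hT (Finset.mem_coe.2 ha.2) (Finset.mem_coe.2 hz) (Ne.symm hza),
          hT (Finset.mem_coe.2 hb.2) (Finset.mem_coe.2 hz) (Ne.symm hzb)⟩
    have h3 := Finset.card_le_card h2
    rw [hG.card_common h1, Finset.card_insert_of_notMem (by simp [hv]), Finset.card_erase_of_mem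
      (by simp [hab.symm, hb.2]), Finset.card_erase_of_mem ha.2, hc] at h3
    omega
  have hsum : ∑ v ∈ Tᶜ, #(G.neighborFinset v ∩ T) = ∑ v ∈ Tᶜ, 1 := by
    rw [sum_card_inter_comm]
    have h1 : ∀ w ∈ T, #(G.neighborFinset w ∩ Tᶜ) = 3 := by
      intro w hw
      have h := card_inter_add_card_inter_compl (G.neighborFinset w) T
      have h2 : G.neighborFinset w ∩ T = T.erase w := by
        ext z
        simp only [mem_inter, mem_neighborFinset, mem_erase]
        exact ⟨fun h => ⟨(G.ne_of_adj h.1).symm, h.2⟩, fun h =>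
          ⟨hT (Finset.mem_coe.2 hw) (Finset.mem_coe.2 h.2) (Ne.symm h.1), h.2⟩⟩
      rw [h2, hG.card_nbr, Finset.card_erase_of_mem hw] at h
      omega
    rw [Finset.sum_congr rfl h1]
    simp only [sum_const, smul_eq_mul, mul_one, Finset.card_compl, hG.card, hc]
  have heq := (Finset.sum_eq_sum_iff_of_le hle).1 hsum
  refine ⟨hT, one_pos, fun v hv => ?_⟩
  rw [← heq v (Finset.mem_compl.2 hv)]
  congr 1
  ext z
  simp [and_comm]

theorem isClique_insert_nbr_compl (hG : G.IsEdgeRegularWith 16 6 2)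
    (hS : G.IsRegularClique 1 S) (hs : #S = 4) {y : V} (hy : y ∈ S) :
    G.IsClique (insert y (G.neighborFinset y ∩ Sᶜ) : Finset V) ∧
      #(insert y (G.neighborFinset y ∩ Sᶜ)) = 4 := by
  have hp : 3 + #S = 6 + 1 := by omega
  refine ⟨fun a ha b hb hab => ?_, ?_⟩
  · simp only [coe_insert, coe_inter, Set.mem_insert_iff, Set.mem_inter_iff, mem_coe,
      mem_neighborFinset, mem_compl] at ha hb
    rcases ha with rfl | ha <;> rcases hb with rfl | hb
    · exact absurd rfl hab
    · exact hb.1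
    · exact ha.1.symm
    · exact adj_of_common_nbr_clique hG hS hp (r := 2) rfl rfl ha.2 hb.2 hab hy ha.1.symm hb.1.symm
  · rw [Finset.card_insert_of_notMem (by simp), card_nbr_compl hG hS hp hy]

/-- Every vertex `u` lies in two 4-cliques that meet only in `u` and cover its neighbours, the row
and the column of `u`. A non-neighbour of `u` has one neighbour in each, and neither is `u`. -/
theorem isStronglyRegular_of_lattice (hG : G.IsEdgeRegularWith 16 6 2) (hne : G ≠ ⊤)
    (hS : G.IsRegularClique 1 S) (hs : #S = 4) : G.IsStronglyRegular := by
  refine hG.isStronglyRegular hne 2 fun u v huv hadj => ?_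
  obtain ⟨T, hT, hTc, hu⟩ : ∃ T : Finset V, G.IsRegularClique 1 T ∧ #T = 4 ∧ u ∈ T := by
    by_cases hu : u ∈ S
    · exact ⟨S, hS, hs, hu⟩
    · obtain ⟨y, hy, huy⟩ := exists_adj_clique hS hu
      obtain ⟨h1, h2⟩ := isClique_insert_nbr_compl hG hS hs hy
      exact ⟨_, isRegularClique_of_card_four hG h1 h2, h2, by simp [hu, huy.symm]⟩
  obtain ⟨h1, h2⟩ := isClique_insert_nbr_compl hG hT hTc hu
  have hT' := isRegularClique_of_card_four hG h1 h2
  have hvT : v ∉ T := fun h => hadj (adj_of_mem_clique hT hu h huv)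
  have hvT' : v ∉ insert u (G.neighborFinset u ∩ Tᶜ) := by simp [huv.symm, hadj]
  rw [← card_inter_add_card_inter_compl (G.neighborFinset u ∩ G.neighborFinset v) T]
  have e1 : G.neighborFinset u ∩ G.neighborFinset v ∩ T = G.neighborFinset v ∩ T := by
    ext z
    simp only [mem_inter, mem_neighborFinset]
    refine ⟨fun h => ⟨h.1.2, h.2⟩, fun h => ⟨⟨adj_of_mem_clique hT hu h.2 ?_, h.1⟩, h.2⟩⟩
    rintro rfl
    exact hadj h.1.symm
  have e2 : G.neighborFinset u ∩ G.neighborFinset v ∩ Tᶜ =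
      G.neighborFinset v ∩ insert u (G.neighborFinset u ∩ Tᶜ) := by
    ext z
    simp only [mem_inter, mem_insert, mem_neighborFinset, mem_compl]
    refine ⟨fun h => ⟨h.1.2, Or.inr ⟨h.1.1, h.2⟩⟩, fun h => ?_⟩
    rcases h.2 with rfl | h'
    · exact absurd h.1.symm hadj
    · exact ⟨⟨h'.1, h.1⟩, h'.2⟩
  rw [e1, e2, card_nexus hT hvT, card_nexus hT' hvT']

/-- The outside neighbours of a clique vertex are mutually adjacent. For the trace `{y, z}` of `x`
these two cliques share only `x` because `t = 1`, so they supply `2 (p - 1) = k - 2` outside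
neighbours of `x`, which is all of them. -/
theorem adj_iff_of_triangular (hG : G.IsEdgeRegularWith n k ℓ) (hS : G.IsRegularClique 2 S)
    (hp : p + #S = k + 1) (hps : p + 1 = #S) (hℓ : ℓ + 1 = #S) {x w : V} (hx : x ∉ S)
    (hw : w ∉ S) (hxw : x ≠ w) : G.Adj x w ↔ ∃ y ∈ S, G.Adj x y ∧ G.Adj w y := by
  have h2S : 2 ≤ #S := by
    have := card_nexus hS hx
    exact this ▸ Finset.card_le_card Finset.inter_subset_right
  have hr : (p - 1) + 2 = ℓ + 1 := by omega
  refine ⟨fun h => ?_, fun ⟨y, hy, h1, h2⟩ =>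
    adj_of_common_nbr_clique hG hS hp hr (by omega) hx hw hxw hy h1 h2⟩
  obtain ⟨y, z, hyz, hB⟩ := Finset.card_eq_two.1 (card_nexus hS hx)
  have hy : y ∈ G.neighborFinset x ∩ S := by rw [hB]; simp
  have hz : z ∈ G.neighborFinset x ∩ S := by rw [hB]; simp
  simp only [mem_inter, mem_neighborFinset] at hy hz
  have hsub : (G.neighborFinset y ∩ Sᶜ).erase x ∪ (G.neighborFinset z ∩ Sᶜ).erase x ⊆
      G.neighborFinset x ∩ Sᶜ := by
    intro a ha
    simp only [mem_union, mem_erase, mem_inter, mem_neighborFinset, mem_compl] at ha ⊢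
    rcases ha with ha | ha
    · exact ⟨adj_of_common_nbr_clique hG hS hp hr (by omega) hx ha.2.2 ha.1.symm hy.2 hy.1
        ha.2.1.symm, ha.2.2⟩
    · exact ⟨adj_of_common_nbr_clique hG hS hp hr (by omega) hx ha.2.2 ha.1.symm hz.2 hz.1
        ha.2.1.symm, ha.2.2⟩
  have hcard : #((G.neighborFinset y ∩ Sᶜ).erase x ∪ (G.neighborFinset z ∩ Sᶜ).erase x) =
      2 * (p - 1) := by
    rw [Finset.card_union_of_disjoint, Finset.card_erase_of_mem (by simp [hx, hy.1.symm]),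
      Finset.card_erase_of_mem (by simp [hx, hz.1.symm]), card_nbr_compl hG hS hp hy.2,
      card_nbr_compl hG hS hp hz.2, two_mul]
    refine Finset.disjoint_left.2 fun a ha hb => ?_
    simp only [mem_erase, mem_inter, mem_neighborFinset, mem_compl] at ha hb
    have h1 := card_common_compl hG hS (t := 1) (by omega) hy.2 hz.2 hyz
    exact ha.1 (Finset.card_le_one.1 h1.le a (by simp [ha.2, hb.2.1]) x
      (by simp [hy.1.symm, hz.1.symm, hx]))
  have heq := Finset.eq_of_subset_of_card_le hsub (by
    have := card_nbr_inter_compl hG hS hx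
    omega)
  have hmem : w ∈ G.neighborFinset x ∩ Sᶜ := by simp [h, hw]
  rw [← heq] at hmem
  simp only [mem_union, mem_erase, mem_inter, mem_neighborFinset, mem_compl] at hmem
  rcases hmem with hmem | hmem
  · exact ⟨y, hy.2, hy.1, hmem.2.1.symm⟩
  · exact ⟨z, hz.2, hz.1, hmem.2.1.symm⟩

/-- A trace of size two that meets both `B` and `C` has one element in each, so every such vertex
contributes exactly one to the double count. -/
theorem card_of_traces_meet (hG : G.IsEdgeRegularWith n k ℓ) (hS : G.IsRegularClique 2 S)
    (ht : t + #S = ℓ + 2) {B C A : Finset V} (hB : B ⊆ S) (hC : C ⊆ S) (hBC : Disjoint B C)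
    (hA : ∀ w, w ∈ A ↔ w ∉ S ∧ (∃ y ∈ B, G.Adj w y) ∧ ∃ y ∈ C, G.Adj w y) :
    #A = #B * #C * t := by
  rw [← sum_card_inter_mul_disjoint hG hS ht hB hC hBC]
  have hAS : A ⊆ Sᶜ := fun w hw => Finset.mem_compl.2 ((hA w).1 hw).1
  rw [← Finset.sum_subset hAS, Finset.sum_congr rfl (g := fun _ => 1), Finset.sum_const, smul_eq_mul,
    mul_one]
  · intro w hw
    obtain ⟨hwS, ⟨y, hy, hwy⟩, z, hz, hwz⟩ := (hA w).1 hw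
    have h1 : 0 < #(G.neighborFinset w ∩ B) := Finset.card_pos.2 ⟨y, by simp [hy, hwy]⟩
    have h2 : 0 < #(G.neighborFinset w ∩ C) := Finset.card_pos.2 ⟨z, by simp [hz, hwz]⟩
    have h3 : #(G.neighborFinset w ∩ B) + #(G.neighborFinset w ∩ C) ≤ 2 := by
      rw [← card_nexus hS hwS, ← Finset.card_union_of_disjoint]
      · rw [← Finset.inter_union_distrib_left]
        exact Finset.card_le_card (Finset.inter_subset_inter_left (Finset.union_subset hB hC))
      · exact hBC.mono Finset.inter_subset_right Finset.inter_subset_right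
    have h4 : #(G.neighborFinset w ∩ B) = 1 := by omega
    have h5 : #(G.neighborFinset w ∩ C) = 1 := by omega
    rw [h4, h5]
  · intro w hw hwA
    by_contra h
    rw [← Ne, mul_ne_zero_iff] at h
    obtain ⟨y, hy⟩ := Finset.card_pos.1 (Nat.pos_of_ne_zero h.1)
    obtain ⟨z, hz⟩ := Finset.card_pos.1 (Nat.pos_of_ne_zero h.2)
    simp only [mem_inter, mem_neighborFinset] at hy hz
    exact hwA ((hA w).2 ⟨Finset.mem_compl.1 hw, ⟨y, hy.2, hy.1⟩, z, hz.2, hz.1⟩)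

/-- Outside adjacency means that traces meet. Thus nonadjacent vertices have `2 + 2 * 1` common
neighbours if one of them lies in `S`, and `0 + 2 * 2` if neither does. -/
theorem isStronglyRegular_of_triangular (hG : G.IsEdgeRegularWith n k ℓ) (hne : G ≠ ⊤)
    (hS : G.IsRegularClique 2 S) (hp : p + #S = k + 1) (hps : p + 1 = #S) (hℓ : ℓ + 1 = #S) :
    G.IsStronglyRegular := by
  have mixed : ∀ x y, x ∉ S → y ∈ S → ¬ G.Adj x y →
      #(G.neighborFinset x ∩ G.neighborFinset y) = 4 := by
    intro x y hx hy hxy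
    rw [← card_inter_add_card_inter_compl _ S]
    have e1 : G.neighborFinset x ∩ G.neighborFinset y ∩ S = G.neighborFinset x ∩ S := by
      ext z
      simp only [mem_inter, mem_neighborFinset]
      refine ⟨fun h => ⟨h.1.1, h.2⟩, fun h => ⟨⟨h.1, adj_of_mem_clique hS hy h.2 ?_⟩, h.2⟩⟩
      rintro rfl
      exact hxy h.1
    have e2 := card_of_traces_meet hG hS (t := 1) (by omega) (B := G.neighborFinset x ∩ S) (C := {y})
      (A := G.neighborFinset x ∩ G.neighborFinset y ∩ Sᶜ) Finset.inter_subset_right (by simpa)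
      (by simp [hxy]) (by
        intro w
        simp only [mem_inter, mem_neighborFinset, mem_compl, mem_singleton, exists_eq_left]
        constructor
        · rintro ⟨⟨h1, h2⟩, h3⟩
          obtain ⟨z, hz, h4, h5⟩ := (adj_iff_of_triangular hG hS hp hps hℓ hx h3
            (G.ne_of_adj h1)).1 h1
          exact ⟨h3, ⟨z, ⟨h4, hz⟩, h5⟩, h2.symm⟩
        · rintro ⟨h3, ⟨z, ⟨h4, hz⟩, h5⟩, h2⟩
          have hxw : x ≠ w := by rintro rfl; exact hxy h2
          exact ⟨⟨(adj_iff_of_triangular hG hS hp hps hℓ hx h3 hxw).2 ⟨z, hz, h4, h5⟩, h2.symm⟩, h3⟩)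
    rw [e1, e2, card_nexus hS hx, Finset.card_singleton]
  refine hG.isStronglyRegular hne 4 fun x z hxz hadj => ?_
  by_cases hx : x ∈ S <;> by_cases hz : z ∈ S
  · exact absurd (adj_of_mem_clique hS hx hz hxz) hadj
  · rw [Finset.inter_comm]
    exact mixed z x hz hx fun h => hadj h.symm
  · exact mixed x z hx hz hadj
  · have hno : ∀ y ∈ S, G.Adj x y → ¬ G.Adj z y := fun y hy h1 h2 =>
      hadj ((adj_iff_of_triangular hG hS hp hps hℓ hx hz hxz).2 ⟨y, hy, h1, h2⟩)
    rw [← card_inter_add_card_inter_compl _ S]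
    have e1 : G.neighborFinset x ∩ G.neighborFinset z ∩ S = ∅ := by
      ext y
      simp only [mem_inter, mem_neighborFinset, notMem_empty, iff_false]
      exact fun h => hno y h.2 h.1.1 h.1.2
    have e2 := card_of_traces_meet hG hS (t := 1) (by omega) (B := G.neighborFinset x ∩ S)
      (C := G.neighborFinset z ∩ S)
      (A := G.neighborFinset x ∩ G.neighborFinset z ∩ Sᶜ) Finset.inter_subset_right
      Finset.inter_subset_right
      (Finset.disjoint_left.2 fun y h1 h2 => by
        simp only [mem_inter, mem_neighborFinset] at h1 h2
        exact hno y h1.2 h1.1 h2.1) (by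
        intro w
        simp only [mem_inter, mem_neighborFinset, mem_compl]
        constructor
        · rintro ⟨⟨h1, h2⟩, h3⟩
          obtain ⟨y, hy, h4, h5⟩ := (adj_iff_of_triangular hG hS hp hps hℓ hx h3
            (G.ne_of_adj h1)).1 h1
          obtain ⟨y', hy', h4', h5'⟩ := (adj_iff_of_triangular hG hS hp hps hℓ hz h3
            (G.ne_of_adj h2)).1 h2
          exact ⟨h3, ⟨y, ⟨h4, hy⟩, h5⟩, y', ⟨h4', hy'⟩, h5'⟩
        · rintro ⟨h3, ⟨y, ⟨h4, hy⟩, h5⟩, y', ⟨h4', hy'⟩, h5'⟩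
          have hxw : x ≠ w := by rintro rfl; exact hno y' hy' h5' h4'
          have hzw : z ≠ w := by rintro rfl; exact hno y hy h4 h5
          exact ⟨⟨(adj_iff_of_triangular hG hS hp hps hℓ hx h3 hxw).2 ⟨y, hy, h4, h5⟩,
            (adj_iff_of_triangular hG hS hp hps hℓ hz h3 hzw).2 ⟨y', hy', h4', h5'⟩⟩, h3⟩)
    rw [e1, e2, card_nexus hS hx, card_nexus hS hz, Finset.card_empty]

/-- Each outside vertex has two outside non-neighbours, whose traces meet its own in one and in two
elements. Starting from an overlap of two, the non-neighbours close up to a triangle, on which such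
overlaps cannot be distributed. -/
theorem not_isRegularClique_of_fifteen (hG : G.IsEdgeRegularWith 15 10 6) (hne : G ≠ ⊤)
    (hS : G.IsRegularClique 3 S) (hs : #S = 5) : False := by
  have hp : 6 + #S = 10 + 1 := by omega
  have ho : 10 + #S = 15 := by omega
  have ht : 3 + #S = 6 + 2 := by omega
  have hr : 4 + 3 = 6 + 1 := rfl
  have hcard : ∀ x, x ∉ S → #(outerNonNbrs G S x) = 2 := fun x hx => by
    have := card_outerNonNbrs hG hS ho hx
    omega
  have hsum : ∀ x, x ∉ S →
      ∑ w ∈ outerNonNbrs G S x, #(G.neighborFinset w ∩ (G.neighborFinset x ∩ S)) = 3 :=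
    fun x hx => by
      have := sum_trace_nonNbrs hG hS hp hr hx
      omega
  have hsymm : ∀ x w, #(G.neighborFinset w ∩ (G.neighborFinset x ∩ S)) =
      #(G.neighborFinset x ∩ (G.neighborFinset w ∩ S)) := fun x w => by
    rw [Finset.inter_left_comm]
  -- With `q = q' = 1` the quadratic sum is exactly zero, so every term vanishes.
  have hrange : ∀ x w, x ∉ S → w ∉ S → w ≠ x →
      #(G.neighborFinset w ∩ (G.neighborFinset x ∩ S)) = 1 ∨
        #(G.neighborFinset w ∩ (G.neighborFinset x ∩ S)) = 2 := by
    intro x w hx hw hwx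
    have h := sum_trace_quadratic hG hS hp ho ht hr hx (fun w => rfl) 1 1
    norm_num at h
    have hnn : ∀ A : Finset V, 0 ≤ ∑ w ∈ A,
        ((#(G.neighborFinset w ∩ (G.neighborFinset x ∩ S)) : ℤ) - 1) *
          (#(G.neighborFinset w ∩ (G.neighborFinset x ∩ S)) - 1 - 1) := fun A =>
      Finset.sum_nonneg fun w _ => consecutive_mul_nonneg _
    obtain ⟨h1, h2⟩ := (add_eq_zero_iff_of_nonneg (hnn _) (hnn _)).1 h
    have hzero : ((#(G.neighborFinset w ∩ (G.neighborFinset x ∩ S)) : ℤ) - 1) *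
        (#(G.neighborFinset w ∩ (G.neighborFinset x ∩ S)) - 1 - 1) = 0 := by
      by_cases hxw : G.Adj x w
      · exact (Finset.sum_eq_zero_iff_of_nonneg fun w _ => consecutive_mul_nonneg _).1 h1 w
          (by simp [hxw, hw])
      · exact (Finset.sum_eq_zero_iff_of_nonneg fun w _ => consecutive_mul_nonneg _).1 h2 w
          (mem_outerNonNbrs.2 ⟨hwx, hw, hxw⟩)
    rcases mul_eq_zero.1 hzero with h | h
    · exact Or.inl (by omega)
    · exact Or.inr (by omega)
  have hpair : ∀ x u, x ∉ S → u ∈ outerNonNbrs G S x → ∃ w, w ≠ u ∧ outerNonNbrs G S x = {u, w} := by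
    intro x u hx hu
    obtain ⟨w, hw⟩ := Finset.card_eq_one.1
      (show #((outerNonNbrs G S x).erase u) = 1 by rw [Finset.card_erase_of_mem hu, hcard x hx])
    have hwm : w ∈ (outerNonNbrs G S x).erase u := by rw [hw]; simp
    exact ⟨w, Finset.ne_of_mem_erase hwm, by rw [← hw, Finset.insert_erase hu]⟩
  -- The count is `p - r - 1 = 1`.
  have hxor : ∀ x y, x ∉ S → y ∈ S → G.Adj x y →
      #(G.neighborFinset y ∩ outerNonNbrs G S x) = 1 := by
    intro x y hx hy hxy
    have h1 := card_nbr_compl hG hS hp hy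
    have h2 := card_common_compl_of_notMem hG hS hr hx hy hxy
    have h3 : G.neighborFinset y ∩ outerNonNbrs G S x =
        ((G.neighborFinset y ∩ Sᶜ) \ (G.neighborFinset x ∩ G.neighborFinset y ∩ Sᶜ)).erase x := by
      ext w
      simp only [mem_inter, mem_neighborFinset, mem_outerNonNbrs, mem_erase, mem_sdiff, mem_compl]
      tauto
    rw [h3, Finset.card_erase_of_mem (by simp [hx, hxy.symm]), Finset.card_sdiff_of_subset, h1, h2]
    intro a ha
    simp only [mem_inter] at ha ⊢
    exact ⟨ha.1.2, ha.2⟩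
  -- `x` has a non-neighbour `u` whose trace meets that of `x` in two elements
  obtain ⟨x, hx⟩ := exists_notMem_clique hne hS
  obtain ⟨u, hu, hau⟩ : ∃ u ∈ outerNonNbrs G S x,
      #(G.neighborFinset u ∩ (G.neighborFinset x ∩ S)) = 2 := by
    by_contra! h
    have h1 := hsum x hx
    rw [Finset.sum_congr rfl (g := fun _ => 1) fun w hw =>
      (hrange x w hx (mem_outerNonNbrs.1 hw).2.1 (mem_outerNonNbrs.1 hw).1).resolve_right (h w hw),
      Finset.sum_const, hcard x hx] at h1
    simp at h1
  have hu' := mem_outerNonNbrs.1 hu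
  have hxu : x ∈ outerNonNbrs G S u :=
    mem_outerNonNbrs.2 ⟨hu'.1.symm, hx, fun h => hu'.2.2 h.symm⟩
  obtain ⟨w, hwu, hDx⟩ := hpair x u hx hu
  obtain ⟨w', hwx', hDu⟩ := hpair u x hu'.2.1 hxu
  have hw := mem_outerNonNbrs.1 (show w ∈ outerNonNbrs G S x by rw [hDx]; simp)
  have hw' := mem_outerNonNbrs.1 (show w' ∈ outerNonNbrs G S u by rw [hDu]; simp)
  -- A trace of size three that avoids the two common elements is the whole complement in the
  -- 5-clique.
  have trace : ∀ v, v ∉ S → (∀ y ∈ S, G.Adj x y → G.Adj u y → ¬ G.Adj v y) →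
      G.neighborFinset v ∩ S = S \ (G.neighborFinset u ∩ (G.neighborFinset x ∩ S)) := by
    intro v hv h
    apply Finset.eq_of_subset_of_card_le
    · intro y hy
      simp only [mem_inter, mem_neighborFinset, mem_sdiff] at hy ⊢
      exact ⟨hy.2, fun h' => h y hy.2 h'.2.1 h'.1 hy.1⟩
    · rw [card_nexus hS hv, Finset.card_sdiff_of_subset (fun y hy => by simp_all), hs, hau]
  have none : ∀ a b c y, a ∉ S → y ∈ S → b ≠ c → outerNonNbrs G S a = {b, c} → G.Adj a y →
      G.Adj b y → ¬ G.Adj c y := by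
    intro a b c y ha hy hbc hD hay hby hcy
    have h1 := hxor a y ha hy hay
    exact hbc (Finset.card_le_one.1 h1.le b (by simp [hD, hby.symm]) c (by simp [hD, hcy.symm]))
  have tw := trace w hw.2.1 fun y hy h1 h2 => none x u w y hx hy hwu.symm hDx h1 h2
  have tw' := trace w' hw'.2.1 fun y hy h1 h2 => none u x w' y hu'.2.1 hy hwx'.symm hDu h2 h1
  -- Otherwise `w` and `w'` would be distinct vertices with equal traces, overlapping in three
  -- elements.
  have hww : w = w' := by
    by_contra hne'
    have h1 := hrange w' w hw'.2.1 hw.2.1 hne'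
    rw [tw', ← tw, ← Finset.inter_assoc, Finset.inter_self, card_nexus hS hw.2.1] at h1
    omega
  subst hww
  have hDw : outerNonNbrs G S w = {x, u} := by
    symm
    apply Finset.eq_of_subset_of_card_le
    · intro a ha
      rcases Finset.mem_insert.1 ha with rfl | ha
      · exact mem_outerNonNbrs.2 ⟨hw.1.symm, hx, fun h => hw.2.2 h.symm⟩
      · rw [Finset.mem_singleton.1 ha]
        exact mem_outerNonNbrs.2 ⟨hw'.1.symm, hu'.2.1, fun h => hw'.2.2 h.symm⟩
    · rw [hcard w hw.2.1, Finset.card_pair hu'.1.symm]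
  -- The three overlaps in the triangle add up to `3` at each vertex, so twice their total would be
  -- `9`.
  have s1 := hsum x hx
  have s2 := hsum u hu'.2.1
  have s3 := hsum w hw.2.1
  rw [hDx, Finset.sum_pair hwu.symm] at s1
  rw [hDu, Finset.sum_pair hwx'.symm] at s2
  rw [hDw, Finset.sum_pair hu'.1.symm] at s3
  rw [hsymm w x, hsymm w u] at s3
  rw [hsymm u x] at s2
  omega

/-- Giving `p` and `t` by formulas leaves only `s`, `o`, `m` to enumerate. -/
theorem regularClique_parameters_aux : ∀ s o : Fin 25, s.1 + o.1 ≤ 24 → ∀ m : Fin 25, m.1 < s.1 →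
    0 < m.1 → ∀ p, p = o.1 * m.1 / s.1 → ∀ t, t = (o.1 * (m.1 * m.1) / s.1 - p) / (s.1 - 1) →
    s.1 * p = o.1 * m.1 → s.1 * (p + (s.1 - 1) * t) = o.1 * (m.1 * m.1) → 2 * p < o.1 + t →
    t + s.1 < p + m.1 + 1 → 2 ∣ (s.1 + o.1) * (p + s.1 - 1) →
    3 ∣ (s.1 + o.1) * (p + s.1 - 1) * (t + s.1 - 2) →
    s.1 = 3 ∧ m.1 = 1 ∨ m.1 = 2 ∧ t = 1 ∧ p + 1 = s.1 ∨
    (s.1, o.1, m.1, p, t) ∈ [(4, 12, 1, 3, 0), (6, 10, 3, 5, 2), (7, 14, 3, 6, 2),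
      (7, 14, 4, 8, 4), (9, 12, 6, 8, 5), (8, 14, 4, 7, 3), (5, 10, 3, 6, 3), (4, 12, 2, 6, 2),
      (4, 18, 2, 9, 3), (4, 20, 1, 5, 0)] := by
  simp only [forall_eq]
  decide +kernel

/-- The possible sizes of a regular clique in a Neumaier graph on at most `24` vertices. -/
theorem regularClique_parameters {s o m p t : ℕ} (hn : s + o ≤ 24) (hm : m < s) (h0 : 0 < m)
    (h1 : s * p = o * m) (h2 : s * (p + (s - 1) * t) = o * (m * m)) (h3 : 2 * p < o + t)
    (h4 : t + s < p + m + 1) (h5 : 2 ∣ (s + o) * (p + s - 1))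
    (h6 : 3 ∣ (s + o) * (p + s - 1) * (t + s - 2)) :
    s = 3 ∧ m = 1 ∨ m = 2 ∧ t = 1 ∧ p + 1 = s ∨
    (s, o, m, p, t) ∈ [(4, 12, 1, 3, 0), (6, 10, 3, 5, 2), (7, 14, 3, 6, 2),
      (7, 14, 4, 8, 4), (9, 12, 6, 8, 5), (8, 14, 4, 7, 3), (5, 10, 3, 6, 3), (4, 12, 2, 6, 2),
      (4, 18, 2, 9, 3), (4, 20, 1, 5, 0)] := by
  refine regularClique_parameters_aux ⟨s, by omega⟩ ⟨o, by omega⟩ hn ⟨m, by omega⟩ hm h0 p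
    (Nat.div_eq_of_eq_mul_right (by omega) h1.symm).symm t ?_ h1 h2 h3 h4 h5 h6
  show t = (o * (m * m) / s - p) / (s - 1)
  rw [← h2, Nat.mul_div_cancel_left _ (by omega), Nat.add_sub_cancel_left,
    Nat.mul_div_cancel_left _ (by omega)]

end SmallCases

end SimpleGraph

/-! ### The surviving parameters up to 24 vertices. -/

namespace SimpleGraph

section Parameters

variable {V : Type*} [Fintype V] [DecidableEq V] {G : SimpleGraph V} [DecidableRel G.Adj]
  {n k ℓ m : ℕ} {S : Finset V}

/-- Guarantees that none of the subtractions defining `o`, `p`, `t` is truncated. -/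
theorem exists_clique_numbers (hG : G.IsEdgeRegularWith n k ℓ) (hS : G.IsRegularClique m S)
    (h2 : 2 ≤ #S) : ∃ o p t, o + #S = n ∧ p + #S = k + 1 ∧ t + #S = ℓ + 2 := by
  obtain ⟨y, hy, z, hz, hyz⟩ := Finset.one_lt_card.1 h2
  have h3 : #S ≤ n := hG.card ▸ Finset.card_le_univ S
  have h4 : #S ≤ k + 1 := by
    have h := card_inter_add_card_inter_compl (G.neighborFinset y) S
    rw [neighborFinset_inter_clique hS hy, hG.card_nbr, Finset.card_erase_of_mem hy] at h
    omega
  have h5 : #S ≤ ℓ + 2 := by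
    have h : (S.erase y).erase z ⊆ G.neighborFinset y ∩ G.neighborFinset z := by
      intro w hw
      simp only [mem_erase] at hw
      simp only [mem_inter, mem_neighborFinset]
      exact ⟨adj_of_mem_clique hS hy hw.2.2 hw.2.1.symm, adj_of_mem_clique hS hz hw.2.2 hw.1.symm⟩
    have h := Finset.card_le_card h
    rw [hG.card_common (adj_of_mem_clique hS hy hz hyz), Finset.card_erase_of_mem
      (Finset.mem_erase.2 ⟨hyz.symm, hz⟩), Finset.card_erase_of_mem hy] at h
    omega
  exact ⟨n - #S, k + 1 - #S, ℓ + 2 - #S, by omega, by omega, by omega⟩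

theorem parameters_of_not_isStronglyRegular (hG : G.IsEdgeRegularWith n k ℓ) (hne : G ≠ ⊤)
    (hS : G.IsRegularClique m S) (hsrg : ¬ G.IsStronglyRegular) (hn : n ≤ 24) :
    (n, k, ℓ, m, #S) = (16, 9, 4, 2, 4) ∨ (n, k, ℓ, m, #S) = (22, 12, 5, 2, 4) ∨
      (n, k, ℓ, m, #S) = (24, 8, 2, 1, 4) := by
  have hm := nexus_lt_card hG hne hS
  have hm0 := hS.pos
  obtain ⟨o, p, t, ho, hp, ht⟩ := exists_clique_numbers hG hS (by omega)
  obtain ⟨r, hr⟩ : ∃ r, r + m = ℓ + 1 := ⟨ℓ + 1 - m, by omega⟩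
  have hrp := local_lt hG hne hS hp hr
  have h2k : 2 * k < n + ℓ :=
    lt_of_le_of_ne hG.two_mul_le fun h => hsrg (hG.isStronglyRegular_of_two_mul_eq hne h)
  have hk : k = p + #S - 1 := by omega
  have hℓ : ℓ = t + #S - 2 := by omega
  have hn' : n = #S + o := by omega
  have h1 := clique_mul_eq hG hS hp ho
  have h2 := clique_mul_mul_eq hG hS hp ho ht
  have hquad := trace_quadratic_nonneg hG hne hS hp ho ht hr
  rcases regularClique_parameters (by omega) hm hm0 h1 h2 (by omega) (by omega)
    (by rw [← hn', ← hk]; exact hG.two_dvd) (by rw [← hn', ← hk, ← hℓ]; exact hG.three_dvd)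
    with ⟨hs, rfl⟩ | ⟨rfl, rfl, hps⟩ | h
  · obtain rfl : ℓ = 1 := by
      have : t = 0 := by
        rw [hs] at h1 h2
        omega
      omega
    exact absurd (isStronglyRegular_of_triangles hG hne (by rw [hs] at h1; omega)) hsrg
  · exact absurd (isStronglyRegular_of_triangular hG hne hS hp hps (by omega)) hsrg
  · simp only [List.mem_cons, Prod.mk.injEq, List.not_mem_nil, or_false] at h
    rcases h with ⟨hs, rfl, rfl, rfl, rfl⟩ | ⟨hs, rfl, rfl, rfl, rfl⟩ | ⟨hs, rfl, rfl, rfl, rfl⟩ |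
      ⟨hs, rfl, rfl, rfl, rfl⟩ | ⟨hs, rfl, rfl, rfl, rfl⟩ | ⟨hs, rfl, rfl, rfl, rfl⟩ |
      ⟨hs, rfl, rfl, rfl, rfl⟩ | ⟨hs, rfl, rfl, rfl, rfl⟩ | ⟨hs, rfl, rfl, rfl, rfl⟩ |
      ⟨hs, rfl, rfl, rfl, rfl⟩ <;>
    rw [hs] at hk hℓ hn' <;> norm_num at hk hℓ hn' <;> subst hk hℓ hn'
    · exact absurd (isStronglyRegular_of_lattice hG hne hS hs) hsrg
    · obtain rfl : r = 4 := by omega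
      -- Here and below, `q` and `q'` are the integer parts of the mean intersections of the trace
      -- of an outside vertex with those of its outside neighbours and non-neighbours. The resulting
      -- bound is negative.
      have := hquad 1 0
      norm_num at this
    · obtain rfl : r = 5 := by omega
      have := hquad 1 0
      norm_num at this
    · obtain rfl : r = 6 := by omega
      have := hquad 2 1
      norm_num at this
    · obtain rfl : r = 7 := by omega
      have := hquad 4 0
      norm_num at this
    · obtain rfl : r = 6 := by omega
      have := hquad 2 0
      norm_num at this
    · exact (not_isRegularClique_of_fifteen hG hne hS hs).elim
    · exact Or.inl (by rw [hs])
    · exact Or.inr (Or.inl (by rw [hs]))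
    · exact Or.inr (Or.inr (by rw [hs]))

end Parameters

end SimpleGraph

namespace SimpleGraph

/-! ### A search for adjacency matrices

The rows of an adjacency matrix are encoded as natural numbers. The functions below are written with
recursors, which makes their evaluation by the kernel fast. -/

namespace RowSearch

/-- The number of ones in the binary expansion of `v < 2 ^ 26`: five copies of `v` are placed side by
side, and every fifth digit is added up modulo `31`. -/
def popcount (v : ℕ) : ℕ :=
  Nat.mod (Nat.land (Nat.mul 20282409905883129831204239441921 v) 43907402183346898511403175152486220833) 31

/-- Number with ones at the first `J` multiples of five. -/
def fifthMask : ℕ → ℕ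
  | 0 => 0
  | J + 1 => 32 * fifthMask J + 1

/-- Digit `5 j` has weight `32 ^ j`, which is `1` modulo `31`. -/
theorem land_fifthMask_mod (J : ℕ) : ∀ x : ℕ,
    (x &&& fifthMask J) % 31 = (∑ j ∈ range J, (x.testBit (5 * j)).toNat) % 31 := by
  induction J with
  | zero => intro x; simp [fifthMask]
  | succ J ih =>
    intro x
    have h : x &&& fifthMask (J + 1) = 32 * ((x / 32) &&& fifthMask J) + (x.testBit 0).toNat := by
      apply Nat.eq_of_testBit_eq
      intro i
      have hx := Nat.div_add_mod x 32
      rw [fifthMask, show 32 = 2 ^ 5 from rfl, Nat.testBit_two_pow_mul_add _ (by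
        cases x.testBit 0 <;> simp), Nat.testBit_and,
        Nat.testBit_two_pow_mul_add _ (by norm_num : 1 < 2 ^ 5), Nat.testBit_and,
        Nat.testBit_div_two_pow]
      by_cases hi : i < 5
      · simp only [hi, if_true]
        rcases i with _ | i
        · cases x.testBit 0 <;> simp
        · have : Nat.testBit 1 (i + 1) = false := by
            rw [Nat.testBit_succ]; simp
          rw [this]
          cases x.testBit 0 <;> simp [Nat.testBit_succ]
      · simp only [hi, if_false]
        rw [Nat.sub_add_cancel (by omega)]
    have h2 : ∀ j, (x / 32).testBit (5 * j) = x.testBit (5 * (j + 1)) := fun j => by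
      rw [show 32 = 2 ^ 5 from rfl, Nat.testBit_div_two_pow, mul_add, mul_one]
    have h3 := ih (x / 32)
    simp only [h2] at h3
    rw [h, Finset.sum_range_succ', mul_zero]
    omega

/-- Since `5` is coprime to `26`, every fifth digit of five adjacent copies hits each digit of `v`
exactly once. -/
theorem sum_testBit_copies {v : ℕ} (hv : v < 2 ^ 26) :
    (∑ j ∈ range 26, ((2 ^ 26 * (2 ^ 26 * (2 ^ 26 * (2 ^ 26 * v + v) + v) + v) + v).testBit
      (5 * j)).toNat) = ∑ j ∈ range 26, (v.testBit j).toNat := by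
  simp only [Finset.sum_range_succ, Finset.sum_range_zero, Nat.testBit_two_pow_mul_add _ hv]
  norm_num
  ring

theorem mod_land_mul {M mask v : ℕ} (hM : M = 2 ^ 104 + 2 ^ 78 + 2 ^ 52 + 2 ^ 26 + 1)
    (hmask : mask = fifthMask 26) (hv : v < 2 ^ 26) :
    Nat.mod (Nat.land (Nat.mul M v) mask) 31 = #{j ∈ range 26 | v.testBit j} := by
  have hmul : Nat.mul M v =
      2 ^ 26 * (2 ^ 26 * (2 ^ 26 * (2 ^ 26 * v + v) + v) + v) + v := by
    rw [Nat.mul_eq, hM]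
    ring
  have hland : ∀ x, Nat.mod (Nat.land x mask) 31 = (x &&& mask) % 31 := fun x => rfl
  have hcard : #{j ∈ range 26 | v.testBit j} = ∑ j ∈ range 26, (v.testBit j).toNat := by
    rw [Finset.card_filter]
    exact Finset.sum_congr rfl fun j _ => by cases v.testBit j <;> rfl
  -- The count is below `31`, so the reduction modulo `31` loses nothing.
  have hlt : #{j ∈ range 26 | v.testBit j} ≤ 26 := by
    simpa using Finset.card_filter_le (range 26) (fun j => v.testBit j)
  rw [hcard] at hlt ⊢
  rw [hland, hmask, land_fifthMask_mod, hmul, sum_testBit_copies hv, Nat.mod_eq_of_lt (by omega)]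

theorem popcount_eq {v : ℕ} (hv : v < 2 ^ 26) :
    popcount v = #{j ∈ range 26 | v.testBit j} :=
  mod_land_mul (by norm_num) (by simp [fifthMask]) hv

/-- The rows in `D` with a one at `i` that have `L` ones in common with the row `v`. -/
noncomputable def keepAdj (L i v : ℕ) (D : List ℕ) : List ℕ → List ℕ :=
  @List.rec ℕ (fun _ => List ℕ → List ℕ) (fun acc => acc)
    (fun w _ ih acc => @Bool.rec (fun _ => List ℕ) (ih acc)
      (@Bool.rec (fun _ => List ℕ) (ih acc) (ih (w :: acc))
        (Nat.beq (Nat.mod (Nat.land (Nat.mul 20282409905883129831204239441921 (Nat.land v w)) 43907402183346898511403175152486220833) 31) L))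
      (Nat.beq (Nat.land (Nat.shiftRight w i) 1) 1)) D

/-- The rows in `D` with a zero at `i`. -/
noncomputable def keepNonadj (i : ℕ) (D : List ℕ) : List ℕ → List ℕ :=
  @List.rec ℕ (fun _ => List ℕ → List ℕ) (fun acc => acc)
    (fun w _ ih acc => @Bool.rec (fun _ => List ℕ) (ih acc) (ih (w :: acc))
      (Nat.beq (Nat.land (Nat.shiftRight w i) 1) 0)) D

/-- Restrict the domains of the remaining rows to those compatible with the row `v` of `i`. -/
noncomputable def propagate (L i v : ℕ) (d : List (ℕ × List ℕ)) :
    List (ℕ × List ℕ) → Option (List (ℕ × List ℕ)) :=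
  @List.rec (ℕ × List ℕ) (fun _ => List (ℕ × List ℕ) → Option (List (ℕ × List ℕ)))
    (fun acc => some acc)
    (fun p _ ih acc => @Prod.rec ℕ (List ℕ) (fun _ => Option (List (ℕ × List ℕ)))
      (fun j D => @List.rec ℕ (fun _ => Option (List (ℕ × List ℕ))) none
        (fun w l _ => ih ((j, w :: l) :: acc))
        (@Bool.rec (fun _ => List ℕ) (keepAdj L i v D []) (keepNonadj i D [])
          (Nat.beq (Nat.land (Nat.shiftRight v j) 1) 0))) p) d

/-- Whether the first list is at most as long as the second. -/
noncomputable def shorter (l : List ℕ) : List ℕ → Bool :=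
  @List.rec ℕ (fun _ => List ℕ → Bool) (fun _ => true)
    (fun _ _ ih m => @List.rec ℕ (fun _ => Bool) false (fun _ m' _ => ih m') m) l

/-- Extract a row with the smallest domain. -/
noncomputable def select (l : List (ℕ × List ℕ)) :
    (ℕ × List ℕ) → List (ℕ × List ℕ) → (ℕ × List ℕ) × List (ℕ × List ℕ) :=
  @List.rec (ℕ × List ℕ)
    (fun _ => (ℕ × List ℕ) → List (ℕ × List ℕ) → (ℕ × List ℕ) × List (ℕ × List ℕ))
    (fun x acc => (x, acc))
    (fun y _ ih x acc => @Bool.rec (fun _ => (ℕ × List ℕ) × List (ℕ × List ℕ))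
      (ih y (x :: acc)) (ih x (y :: acc)) (shorter x.2 y.2)) l

/-- Check all rows in `D` for `i`, where `next` deals with the remaining rows. -/
noncomputable def searchRow (next : List (ℕ × List ℕ) → List (ℕ × ℕ) → Bool) (L i : ℕ)
    (rest : List (ℕ × List ℕ)) (asg : List (ℕ × ℕ)) (D : List ℕ) : Bool :=
  @List.rec ℕ (fun _ => Bool) true
    (fun v _ ih => @Bool.rec (fun _ => Bool) false ih
      (@Option.rec (List (ℕ × List ℕ)) (fun _ => Bool) true
        (fun r => next r ((i, v) :: asg)) (propagate L i v rest []))) D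

/-- Check that all matrices with rows in the given domains satisfy `P`. -/
noncomputable def search (P : List (ℕ × ℕ) → Bool) (L fuel : ℕ) :
    List (ℕ × List ℕ) → List (ℕ × ℕ) → Bool :=
  @Nat.rec (fun _ => List (ℕ × List ℕ) → List (ℕ × ℕ) → Bool) (fun _ _ => false)
    (fun _ next d asg => @List.rec (ℕ × List ℕ) (fun _ => Bool) (P asg)
      (fun x r _ => @Prod.rec (ℕ × List ℕ) (List (ℕ × List ℕ)) (fun _ => Bool)
        (fun p rest => @Prod.rec ℕ (List ℕ) (fun _ => Bool)
          (fun i D => searchRow next L i rest asg D) p) (select r x [])) d) fuel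

theorem beq_shiftRight_one (w i : ℕ) :
    Nat.beq (Nat.land (Nat.shiftRight w i) 1) 1 = w.testBit i := by
  have h : Nat.land (Nat.shiftRight w i) 1 = (w.testBit i).toNat := by
    change (w >>> i) &&& 1 = _
    rw [Nat.and_one_is_mod, Nat.toNat_testBit, Nat.shiftRight_eq_div_pow]
  rw [h]
  cases w.testBit i <;> rfl

theorem beq_shiftRight_zero (w i : ℕ) :
    Nat.beq (Nat.land (Nat.shiftRight w i) 1) 0 = !w.testBit i := by
  have h : Nat.land (Nat.shiftRight w i) 1 = (w.testBit i).toNat := by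
    change (w >>> i) &&& 1 = _
    rw [Nat.and_one_is_mod, Nat.toNat_testBit, Nat.shiftRight_eq_div_pow]
  rw [h]
  cases w.testBit i <;> rfl

theorem keepAdj_cons (L i v w : ℕ) (D acc : List ℕ) : keepAdj L i v (w :: D) acc =
    if w.testBit i ∧ popcount (v &&& w) = L then keepAdj L i v D (w :: acc)
      else keepAdj L i v D acc := by
  have h : keepAdj L i v (w :: D) acc = @Bool.rec (fun _ => List ℕ) (keepAdj L i v D acc)
      (@Bool.rec (fun _ => List ℕ) (keepAdj L i v D acc) (keepAdj L i v D (w :: acc))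
        (Nat.beq (popcount (v &&& w)) L)) (Nat.beq (Nat.land (Nat.shiftRight w i) 1) 1) := rfl
  rw [h, beq_shiftRight_one]
  have h2 : Nat.beq (popcount (v &&& w)) L = decide (popcount (v &&& w) = L) := by
    rw [Bool.eq_iff_iff, Nat.beq_eq, decide_eq_true_iff]
  rw [h2]
  cases w.testBit i <;> by_cases h3 : popcount (v &&& w) = L <;> simp [h3]

theorem mem_keepAdj {L i v w : ℕ} (hw : w.testBit i) (hp : popcount (v &&& w) = L) :
    ∀ (D acc : List ℕ), w ∈ D ∨ w ∈ acc → w ∈ keepAdj L i v D acc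
  | [], acc, h => by simpa [keepAdj] using h
  | u :: D, acc, h => by
    rw [keepAdj_cons]
    split_ifs with hu
    · refine mem_keepAdj hw hp D _ ?_
      simp only [List.mem_cons] at h ⊢
      tauto
    · refine mem_keepAdj hw hp D _ ?_
      simp only [List.mem_cons] at h
      rcases h with (rfl | h) | h
      · exact absurd ⟨hw, hp⟩ hu
      · exact Or.inl h
      · exact Or.inr h

theorem keepNonadj_cons (i w : ℕ) (D acc : List ℕ) : keepNonadj i (w :: D) acc =
    if w.testBit i then keepNonadj i D acc else keepNonadj i D (w :: acc) := by
  have h : keepNonadj i (w :: D) acc = @Bool.rec (fun _ => List ℕ) (keepNonadj i D acc)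
      (keepNonadj i D (w :: acc)) (Nat.beq (Nat.land (Nat.shiftRight w i) 1) 0) := rfl
  rw [h, beq_shiftRight_zero]
  cases w.testBit i <;> simp

theorem mem_keepNonadj {i w : ℕ} (hw : w.testBit i = false) :
    ∀ (D acc : List ℕ), w ∈ D ∨ w ∈ acc → w ∈ keepNonadj i D acc
  | [], acc, h => by simpa [keepNonadj] using h
  | u :: D, acc, h => by
    rw [keepNonadj_cons]
    split_ifs with hu
    · refine mem_keepNonadj hw D _ ?_
      simp only [List.mem_cons] at h
      rcases h with (rfl | h) | h
      · rw [hw] at hu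
        exact absurd hu Bool.false_ne_true
      · exact Or.inl h
      · exact Or.inr h
    · refine mem_keepNonadj hw D _ ?_
      simp only [List.mem_cons] at h ⊢
      tauto

theorem propagate_cons (L i v j : ℕ) (D : List ℕ) (d acc : List (ℕ × List ℕ)) :
    propagate L i v ((j, D) :: d) acc =
      @List.rec ℕ (fun _ => Option (List (ℕ × List ℕ))) none
        (fun w l _ => propagate L i v d ((j, w :: l) :: acc))
        (if v.testBit j then keepAdj L i v D [] else keepNonadj i D []) := by
  have h : propagate L i v ((j, D) :: d) acc =
      @List.rec ℕ (fun _ => Option (List (ℕ × List ℕ))) none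
        (fun w l _ => propagate L i v d ((j, w :: l) :: acc))
        (@Bool.rec (fun _ => List ℕ) (keepAdj L i v D []) (keepNonadj i D [])
          (Nat.beq (Nat.land (Nat.shiftRight v j) 1) 0)) := rfl
  rw [h, beq_shiftRight_zero]
  cases v.testBit j <;> simp

/-- The rows `R 0, …, R (n - 1)` form a symmetric matrix, and adjacent rows have `L` common ones. -/
structure IsRowSystem (n L : ℕ) (R : ℕ → ℕ) : Prop where
  symm : ∀ i j, i < n → j < n → (R i).testBit j = (R j).testBit i
  common : ∀ i j, i < n → j < n → (R i).testBit j → popcount (R i &&& R j) = L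

/-- The domains of a partial search contain the given rows. -/
def InDomains (n : ℕ) (R : ℕ → ℕ) (d : List (ℕ × List ℕ)) : Prop :=
  ∀ p ∈ d, p.1 < n ∧ R p.1 ∈ p.2

/-- The soundness invariant: once row `i` is assigned its true value, no true row is filtered out,
so no domain becomes empty. -/
theorem exists_propagate {n L : ℕ} {R : ℕ → ℕ} (hR : IsRowSystem n L R) {i : ℕ} (hi : i < n) :
    ∀ d acc : List (ℕ × List ℕ), InDomains n R d → InDomains n R acc →
      ∃ d', propagate L i (R i) d acc = some d' ∧ InDomains n R d'
  | [], acc, _, hacc => ⟨acc, rfl, hacc⟩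
  | (j, D) :: d, acc, hd, hacc => by
    obtain ⟨hj, hD⟩ := hd (j, D) (by simp)
    rw [propagate_cons]
    have hmem : R j ∈ (if (R i).testBit j then keepAdj L i (R i) D [] else keepNonadj i D []) := by
      split_ifs with h
      · exact mem_keepAdj (by rw [← hR.symm i j hi hj, h]) (hR.common i j hi hj h) D [] (Or.inl hD)
      · exact mem_keepNonadj (by rw [← hR.symm i j hi hj]; simpa using h) D [] (Or.inl hD)
    generalize (if (R i).testBit j then keepAdj L i (R i) D [] else keepNonadj i D []) = E at hmem
    cases E with
    | nil => simp at hmem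
    | cons w l =>
      refine exists_propagate hR hi d ((j, w :: l) :: acc)
        (fun p hp => hd p (List.mem_cons_of_mem _ hp)) fun p hp => ?_
      rcases List.mem_cons.1 hp with rfl | hp
      · exact ⟨hj, hmem⟩
      · exact hacc p hp

/-- Only this inclusion matters for soundness; the minimality of the chosen domain affects speed
alone. -/
theorem mem_of_select : ∀ (l : List (ℕ × List ℕ)) (x : ℕ × List ℕ) (acc : List (ℕ × List ℕ))
    (q : ℕ × List ℕ), q = (select l x acc).1 ∨ q ∈ (select l x acc).2 → q ∈ x :: (l ++ acc)
  | [], x, acc, q, h => by simpa [select] using h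
  | y :: l, x, acc, q, h => by
    have e : select (y :: l) x acc = @Bool.rec (fun _ => (ℕ × List ℕ) × List (ℕ × List ℕ))
      (select l y (x :: acc)) (select l x (y :: acc)) (shorter x.2 y.2) := rfl
    rw [e] at h
    cases hs : shorter x.2 y.2 <;> rw [hs] at h
    · have := mem_of_select l y (x :: acc) q h
      simp only [List.mem_cons, List.mem_append] at this ⊢
      tauto
    · have := mem_of_select l x (y :: acc) q h
      simp only [List.mem_cons, List.mem_append] at this ⊢
      tauto

theorem of_searchRow {n L : ℕ} {R : ℕ → ℕ} (hR : IsRowSystem n L R) {Q : Prop}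
    {next : List (ℕ × List ℕ) → List (ℕ × ℕ) → Bool} {i : ℕ} (hi : i < n)
    {rest : List (ℕ × List ℕ)} (hrest : InDomains n R rest) {asg : List (ℕ × ℕ)}
    (hnext : ∀ d, InDomains n R d → next d ((i, R i) :: asg) = true → Q) :
    ∀ D : List ℕ, R i ∈ D → searchRow next L i rest asg D = true → Q
  | [], hD, _ => by simp at hD
  | v :: D, hD, h => by
    have e : searchRow next L i rest asg (v :: D) =
      @Bool.rec (fun _ => Bool) false (searchRow next L i rest asg D)
      (@Option.rec (List (ℕ × List ℕ)) (fun _ => Bool) true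
        (fun r => next r ((i, v) :: asg)) (propagate L i v rest [])) := rfl
    rw [e] at h
    rcases List.mem_cons.1 hD with rfl | hD
    · obtain ⟨d', hd', hin⟩ := exists_propagate hR hi rest [] hrest (by simp [InDomains])
      rw [hd'] at h
      refine hnext d' hin ?_
      change @Bool.rec (fun _ => Bool) false _ (next d' ((i, R i) :: asg)) = true at h
      cases hb : next d' ((i, R i) :: asg)
      · rw [hb] at h
        exact h
      · rfl
    · refine of_searchRow hR hi hrest hnext D hD ?_
      generalize @Option.rec (List (ℕ × List ℕ)) (fun _ => Bool) true
        (fun r => next r ((i, v) :: asg)) (propagate L i v rest []) = b at h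
      cases b
      · exact absurd h Bool.false_ne_true
      · exact h

/-- The branch that always picks the true row is never pruned, and a successful search has checked
`P` at its leaf. Nothing is claimed about which rows that leaf assigns. -/
theorem of_search {n L : ℕ} {R : ℕ → ℕ} (hR : IsRowSystem n L R) (P : List (ℕ × ℕ) → Bool) :
    ∀ (fuel : ℕ) (d : List (ℕ × List ℕ)) (asg : List (ℕ × ℕ)), InDomains n R d →
      (∀ p ∈ asg, R p.1 = p.2) → search P L fuel d asg = true →
      ∃ asg', P asg' = true ∧ ∀ p ∈ asg', R p.1 = p.2
  | 0, _, _, _, _, h => absurd h Bool.false_ne_true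
  | _ + 1, [], asg, _, hasg, h => ⟨asg, h, hasg⟩
  | k + 1, x :: r, asg, hd, hasg, h => by
    have e : search P L (k + 1) (x :: r) asg =
      @Prod.rec (ℕ × List ℕ) (List (ℕ × List ℕ)) (fun _ => Bool)
        (fun p rest => @Prod.rec ℕ (List ℕ) (fun _ => Bool)
          (fun i D => searchRow (search P L k) L i rest asg D) p) (select r x []) := rfl
    have hsel := mem_of_select r x []
    rw [List.append_nil] at hsel
    rw [e] at h
    rcases hq : select r x [] with ⟨⟨i, D⟩, rest⟩
    rw [hq] at h hsel
    obtain ⟨hi, hD⟩ := hd _ (hsel (i, D) (Or.inl rfl))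
    refine of_searchRow hR hi (fun p hp => hd p (hsel p (Or.inr hp))) (fun d' hd' h' => ?_) D hD h
    refine of_search hR P k d' ((i, R i) :: asg) hd' (fun p hp => ?_) h'
    rcases List.mem_cons.1 hp with rfl | hp
    · rfl
    · exact hasg p hp

end RowSearch

end SimpleGraph

/-! ### Generating the candidate rows. -/

namespace SimpleGraph

namespace RowSearch

/-- The number whose binary digits below `n` are given by `b`. -/
def rowOf (b : ℕ → Bool) (n : ℕ) : ℕ :=
  ((List.range n).map fun j => if b j then 2 ^ j else 0).sum

theorem rowOf_succ (b : ℕ → Bool) (n : ℕ) :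
    rowOf b (n + 1) = 2 ^ n * (b n).toNat + rowOf b n := by
  simp only [rowOf, List.range_succ, List.map_append, List.sum_append, List.map_cons, List.map_nil,
    List.sum_cons, List.sum_nil, add_zero]
  cases b n <;> simp [add_comm]

theorem rowOf_lt (b : ℕ → Bool) : ∀ n, rowOf b n < 2 ^ n
  | 0 => by simp [rowOf]
  | n + 1 => by
    have := rowOf_lt b n
    rw [rowOf_succ, pow_succ]
    have h : (b n).toNat ≤ 1 := by cases b n <;> simp
    nlinarith [Nat.mul_le_mul_left (2 ^ n) h]

theorem testBit_rowOf (b : ℕ → Bool) : ∀ n j, (rowOf b n).testBit j = (decide (j < n) && b j)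
  | 0, j => by simp [rowOf]
  | n + 1, j => by
    rw [rowOf_succ, Nat.testBit_two_pow_mul_add _ (rowOf_lt b n)]
    split_ifs with h
    · rw [testBit_rowOf b n j]
      simp [h, Nat.lt_succ_of_lt h]
    · rcases Nat.lt_or_ge n j with h1 | h1
      · have h2 : ¬ j < n + 1 := by omega
        have h3 : j - n ≠ 0 := by omega
        rw [decide_eq_false h2, Bool.false_and]
        cases b n
        · simp
        · obtain ⟨i, hi⟩ := Nat.exists_eq_succ_of_ne_zero h3
          rw [hi, Nat.succ_eq_add_one, Nat.testBit_succ]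
          simp
      · obtain rfl : j = n := by omega
        cases b j <;> simp

/-- The numbers obtained from `base` by adding `k` of the numbers in a list and omitting `z` of
them. -/
noncomputable def choices : List ℕ → ℕ → ℕ → ℕ → List ℕ → List ℕ :=
  @List.rec ℕ (fun _ => ℕ → ℕ → ℕ → List ℕ → List ℕ) (fun _ _ base acc => base :: acc)
    (fun w _ ih k z base acc => @Nat.rec (fun _ => List ℕ)
      (@Nat.rec (fun _ => List ℕ) acc (fun z' _ => ih k z' base acc) z)
      (fun k' _ => ih k' z (Nat.add base w)
        (@Nat.rec (fun _ => List ℕ) acc (fun z' _ => ih k z' base acc) z)) k)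

theorem mem_choices_of_mem {v : ℕ} : ∀ (l : List ℕ) (k z base : ℕ) (acc : List ℕ), v ∈ acc →
    v ∈ choices l k z base acc
  | [], _, _, _, _, h => List.mem_cons_of_mem _ h
  | _ :: _, 0, 0, _, _, h => h
  | _ :: l, 0, _ + 1, _, _, h => mem_choices_of_mem l _ _ _ _ h
  | _ :: l, _ + 1, 0, _, _, h => mem_choices_of_mem l _ _ _ _ h
  | _ :: l, _ + 1, _ + 1, _, _, h =>
    mem_choices_of_mem l _ _ _ _ (mem_choices_of_mem l _ _ _ _ h)

/-- The two budgets are the exact numbers of ones and zeros of `b`, so the branch following `b`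
never runs out of either. -/
theorem mem_choices (b : ℕ → Bool) : ∀ (l : List ℕ) (base : ℕ) (acc : List ℕ),
    base + (l.map fun j => if b j then 2 ^ j else 0).sum ∈
      choices (l.map fun j => 2 ^ j) (l.countP b) (l.countP fun j => !b j) base acc
  | [], base, acc => by simp [choices]
  | p :: l, base, acc => by
    rw [List.map_cons, List.map_cons, List.sum_cons, ← add_assoc]
    cases hb : b p
    · have ih := mem_choices b l base acc
      rw [List.countP_cons_of_neg (by simp [hb]), List.countP_cons_of_pos (by simp [hb]),
        if_neg (by simp), add_zero]
      generalize l.countP b = k at ih ⊢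
      cases k with
      | zero => exact ih
      | succ k => exact mem_choices_of_mem (l.map fun j => 2 ^ j) k _ (base + 2 ^ p) _ ih
    · have ih := fun acc => mem_choices b l (base + 2 ^ p) acc
      rw [List.countP_cons_of_pos (by simp [hb]), List.countP_cons_of_neg (by simp [hb]), if_pos rfl]
      generalize (l.countP fun j => !b j) = z at ih ⊢
      cases z with
      | zero => exact ih _
      | succ z => exact ih _

/-- The rows of length `n` with `k` ones, where some of the digits are prescribed by `known`. -/
noncomputable def rowsOf (known : ℕ → Option Bool) (k n : ℕ) : List ℕ :=
  let ones := (List.range n).filter fun j => known j == some true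
  let free := (List.range n).filter fun j => known j == none
  choices (free.map fun j => 2 ^ j) (k - ones.length) (free.length - (k - ones.length))
    (ones.map fun j => 2 ^ j).sum []

/-- Used with `f j = 2 ^ j` for the value of a row and with `f j = 1` for its number of ones. -/
theorem sum_eq_of_known {known : ℕ → Option Bool} {b : ℕ → Bool} (f : ℕ → ℕ) : ∀ l : List ℕ,
    (∀ j ∈ l, ∀ c, known j = some c → b j = c) →
    (l.map fun j => if b j then f j else 0).sum =
      ((l.filter fun j => known j == some true).map f).sum +
        ((l.filter fun j => known j == none).map fun j => if b j then f j else 0).sum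
  | [], _ => rfl
  | p :: l, h => by
    have ih := sum_eq_of_known f l fun j hj => h j (List.mem_cons_of_mem _ hj)
    have hp := h p (by simp)
    rw [List.map_cons, List.sum_cons, ih]
    rcases hk : known p with _ | _ | _
    · simp [hk, add_left_comm]
    · simp [hk, hp false hk]
    · simp [hk, hp true hk, add_assoc]

theorem rowOf_mem_rowsOf {known : ℕ → Option Bool} {b : ℕ → Bool} {k n : ℕ}
    (h : ∀ j < n, ∀ c, known j = some c → b j = c) (hk : #{j ∈ range n | b j} = k) :
    rowOf b n ∈ rowsOf known k n := by
  have h' : ∀ j ∈ List.range n, ∀ c, known j = some c → b j = c := fun j hj =>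
    h j (List.mem_range.1 hj)
  have hcount : ∀ l : List ℕ, l.countP b = (l.map fun j => if b j then 1 else 0).sum := by
    intro l
    induction l with
    | nil => rfl
    | cons p l ih => cases hb : b p <;> simp [hb, ih, add_comm]
  have hk' : (List.range n).countP b = k := by
    rw [← hk, List.countP_eq_length_filter, ← List.toFinset_card_of_nodup
      (List.nodup_range.filter _), List.toFinset_filter, List.toFinset_range]
  have h1 := sum_eq_of_known (fun j => 2 ^ j) _ h'
  have h2 := sum_eq_of_known (fun _ => 1) _ h'
  rw [← hcount, ← hcount, hk', List.map_const', List.sum_replicate, smul_eq_mul, mul_one] at h2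
  have h3 := List.length_eq_countP_add_countP b
    (l := (List.range n).filter fun j => known j == none)
  have h4 := mem_choices b ((List.range n).filter fun j => known j == none)
    (((List.range n).filter fun j => known j == some true).map fun j => 2 ^ j).sum []
  rw [rowOf, h1, rowsOf]
  convert h4 using 2
  · omega
  · have h5 : (fun j => !b j) = fun j => decide ¬ b j = true := by
      funext j
      cases b j <;> rfl
    rw [h5]
    omega

/-! ### Labelled graphs with a regular clique of size four

The vertices `0, 1, 2, 3` form the clique, and the vertices `4 + t * c + q` with `q < t` are the
vertices whose trace on the clique is the pair `pairOf c`. -/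

/-- The six pairs of elements of `{0, 1, 2, 3}`. Complementary pairs are consecutive. -/
def pairOf (c : ℕ) : ℕ × ℕ :=
  [(0, 1), (2, 3), (0, 2), (1, 3), (0, 3), (1, 2)].getD c (0, 0)

/-- Adjacency between the clique and the other vertices. -/
def knownClique (t i j : ℕ) : Option Bool :=
  if i < 4 then
    if j < 4 then some (i != j)
    else some (i == (pairOf ((j - 4) / t)).1 || i == (pairOf ((j - 4) / t)).2)
  else if j < 4 then some (j == (pairOf ((i - 4) / t)).1 || j == (pairOf ((i - 4) / t)).2)
  else if i = j then some false
  else none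

/-- Adjacency between two of the six vertices whose traces are a given pair or its complement. -/
def pattern (T : Bool) (a b : ℕ) : Bool :=
  if a / 3 = b / 3 then T && a % 3 + b % 3 == 1
  else if T then !(a % 3 == 2 && b % 3 == 2)
  else a % 3 != b % 3

/-- The adjacencies known when the clique has size four, each trace occurs three times, and the types
of the three pairs of complementary traces are given. -/
def knownPattern (T : ℕ → Bool) (i j : ℕ) : Option Bool :=
  if 4 ≤ i ∧ 4 ≤ j ∧ (i - 4) / 6 = (j - 4) / 6 then
    some (pattern (T ((i - 4) / 6)) ((i - 4) % 6) ((j - 4) % 6))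
  else knownClique 3 i j

/-- A normalization of the labels of six vertices of type `T` with weights `x`. -/
def sortedSix (T : Bool) (x : ℕ → ℕ) : Bool :=
  if T then x 1 ≤ x 0 && x 4 ≤ x 3
  else 2 * x 1 + x 4 ≤ 2 * x 0 + x 3 && 2 * x 2 + x 5 ≤ 2 * x 1 + x 4

/-- Whether the row `v` is sorted on the six vertices of type `T` starting at `b`. -/
def sortedAt (T : Bool) (b v : ℕ) : Bool :=
  sortedSix T fun j => (v.testBit (b + j)).toNat

/-- The domains of the rows in the search for graphs on `22` vertices. -/
noncomputable def domains (T : ℕ → Bool) : List (ℕ × List ℕ) :=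
  (List.range 22).map fun i => (i, (rowsOf (knownPattern T i) 12 22).filter fun v =>
    i != 6 || sortedAt (T 1) 10 v && sortedAt (T 2) 16 v)

end RowSearch

end SimpleGraph

/-! ### The searches on 22 vertices. -/

namespace SimpleGraph

namespace RowSearch

/-- Types of the three pairs of complementary traces, with the pairs of the first type first. -/
def typesOf (r c : ℕ) : Bool := decide (c < r)

-- The predicate is constantly false, so success means that every branch dies. The fuel is one more
-- than the number of rows, as the empty list of domains also needs a step.
set_option maxRecDepth 100000 in
theorem search_types_zero : search (fun _ => false) 5 23 (domains (typesOf 0)) [] = true := by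
  decide +kernel

set_option maxRecDepth 100000 in
theorem search_types_one : search (fun _ => false) 5 23 (domains (typesOf 1)) [] = true := by
  decide +kernel

set_option maxRecDepth 100000 in
theorem search_types_two : search (fun _ => false) 5 23 (domains (typesOf 2)) [] = true := by
  decide +kernel

set_option maxRecDepth 100000 in
theorem search_types_three : search (fun _ => false) 5 23 (domains (typesOf 3)) [] = true := by
  decide +kernel

end RowSearch

end SimpleGraph

/-! ### From graphs to row systems and labellings. -/

namespace SimpleGraph

namespace RowSearch

variable {V : Type*} [Fintype V] [DecidableEq V] {G : SimpleGraph V} [DecidableRel G.Adj]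
  {n k ℓ t : ℕ} {S : Finset V} {f : ℕ → V}

/-- The rows of the adjacency matrix of a graph whose vertices are listed by `f`. -/
def adjRow (G : SimpleGraph V) [DecidableRel G.Adj] (f : ℕ → V) (n i : ℕ) : ℕ :=
  rowOf (fun j => decide (G.Adj (f i) (f j))) n

omit [Fintype V] [DecidableEq V] in
theorem testBit_adjRow {i j : ℕ} (hj : j < n) :
    (adjRow G f n i).testBit j = decide (G.Adj (f i) (f j)) := by
  rw [adjRow, testBit_rowOf, decide_eq_true hj, Bool.true_and]

theorem image_range_eq_univ (hf : Set.InjOn f (range n)) (hn : Fintype.card V = n) :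
    (range n).image f = Finset.univ := by
  rw [← Finset.card_eq_iff_eq_univ, Finset.card_image_of_injOn hf, Finset.card_range, hn]

theorem card_filter_range (hf : Set.InjOn f (range n)) (hn : Fintype.card V = n) (A : Finset V) :
    #{j ∈ range n | f j ∈ A} = #A := by
  have h : ({j ∈ range n | f j ∈ A} : Finset ℕ).image f = A := by
    ext x
    have hx : x ∈ (range n).image f := by
      rw [image_range_eq_univ hf hn]
      exact Finset.mem_univ x
    obtain ⟨j, hj, rfl⟩ := Finset.mem_image.1 hx
    refine ⟨fun h => ?_, fun h => Finset.mem_image_of_mem f (Finset.mem_filter.2 ⟨hj, h⟩)⟩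
    obtain ⟨i, hi, e⟩ := Finset.mem_image.1 h
    exact e ▸ (Finset.mem_filter.1 hi).2
  rw [← Finset.card_image_of_injOn (f := f) (hf.mono (Finset.coe_subset.2
    (Finset.filter_subset _ _))), h]

theorem card_filter_adj (hG : G.IsEdgeRegularWith n k ℓ) (hf : Set.InjOn f (range n)) (i : ℕ) :
    #{j ∈ range n | decide (G.Adj (f i) (f j)) = true} = k := by
  rw [← hG.card_nbr (f i), ← card_filter_range hf hG.card]
  simp only [decide_eq_true_eq, mem_neighborFinset]

theorem popcount_adjRow (hn : Fintype.card V = n) (hf : Set.InjOn f (range n))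
    (hle : n ≤ 26) (i j : ℕ) : popcount (adjRow G f n i &&& adjRow G f n j) =
      #(G.neighborFinset (f i) ∩ G.neighborFinset (f j)) := by
  have hlt : adjRow G f n i &&& adjRow G f n j < 2 ^ 26 :=
    lt_of_le_of_lt Nat.and_le_left
      (lt_of_lt_of_le (rowOf_lt _ n) (Nat.pow_le_pow_right (by norm_num) hle))
  rw [popcount_eq hlt, ← card_filter_range hf hn]
  congr 1
  ext l
  simp only [Finset.mem_filter, Finset.mem_range, Finset.mem_inter, mem_neighborFinset,
    Nat.testBit_and, adjRow, testBit_rowOf, Bool.and_eq_true, decide_eq_true_eq]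
  constructor
  · rintro ⟨-, ⟨h1, h2⟩, -, h3⟩
    exact ⟨h1, h2, h3⟩
  · rintro ⟨h1, h2, h3⟩
    exact ⟨by omega, ⟨h1, h2⟩, h1, h3⟩

theorem isRowSystem_adjRow (hG : G.IsEdgeRegularWith n k ℓ) (hf : Set.InjOn f (range n))
    (hle : n ≤ 26) : IsRowSystem n ℓ (adjRow G f n) where
  symm i j hi hj := by
    rw [testBit_adjRow hi, testBit_adjRow hj]
    simp only [G.adj_comm]
  common i j hi hj h := by
    rw [testBit_adjRow hj, decide_eq_true_eq] at h
    rw [popcount_adjRow hG.card hf hle, hG.card_common h]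

theorem adjRow_mem_rowsOf (hG : G.IsEdgeRegularWith n k ℓ) (hf : Set.InjOn f (range n)) {i : ℕ}
    {known : ℕ → Option Bool}
    (h : ∀ j < n, ∀ c, known j = some c → (G.Adj (f i) (f j) ↔ c = true)) :
    adjRow G f n i ∈ rowsOf known k n := by
  refine rowOf_mem_rowsOf (fun j hj c hc => ?_) (card_filter_adj hG hf i)
  have := h j hj c hc
  cases c <;> simp_all

/-- The vertices outside `S` that are adjacent to `a` and `b`. -/
def traceClass (G : SimpleGraph V) [DecidableRel G.Adj] (S : Finset V) (a b : V) : Finset V :=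
  G.neighborFinset a ∩ G.neighborFinset b ∩ Sᶜ

theorem mem_traceClass {a b x : V} :
    x ∈ traceClass G S a b ↔ x ∉ S ∧ G.Adj x a ∧ G.Adj x b := by
  simp only [traceClass, Finset.mem_inter, mem_neighborFinset, Finset.mem_compl, G.adj_comm x]
  tauto

/-- In a `2`-regular clique, a vertex of the class of `a` and `b` is adjacent to no other vertex of
the clique. -/
theorem adj_iff_of_mem_traceClass (hS : G.IsRegularClique 2 S) {a b c x : V} (ha : a ∈ S)
    (hb : b ∈ S) (hab : a ≠ b) (hc : c ∈ S) (hx : x ∈ traceClass G S a b) :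
    G.Adj x c ↔ c = a ∨ c = b := by
  obtain ⟨hxS, hxa, hxb⟩ := mem_traceClass.1 hx
  have h1 : ({a, b} : Finset V) = G.neighborFinset x ∩ S := by
    refine Finset.eq_of_subset_of_card_le ?_ ?_
    · intro y hy
      rw [Finset.mem_insert, Finset.mem_singleton] at hy
      rw [Finset.mem_inter, mem_neighborFinset]
      rcases hy with rfl | rfl
      · exact ⟨hxa, ha⟩
      · exact ⟨hxb, hb⟩
    · rw [card_nexus hS hxS, Finset.card_pair hab]
  have h2 : c ∈ ({a, b} : Finset V) ↔ G.Adj x c ∧ c ∈ S := by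
    rw [h1, Finset.mem_inter, mem_neighborFinset]
  rw [Finset.mem_insert, Finset.mem_singleton] at h2
  tauto

/-- The vertices are listed by `f`, starting with the vertices of `S`, followed by the classes with
the six traces. -/
structure IsCliqueLabelling (G : SimpleGraph V) [DecidableRel G.Adj] (S : Finset V) (t : ℕ)
    (f : ℕ → V) : Prop where
  mem : ∀ i < 4, f i ∈ S
  inj : ∀ i < 4, ∀ j < 4, f i = f j → i = j
  mem_class : ∀ c < 6, ∀ q < t,
    f (4 + t * c + q) ∈ traceClass G S (f (pairOf c).1) (f (pairOf c).2)
  inj_class : ∀ c < 6, ∀ q < t, ∀ q' < t, f (4 + t * c + q) = f (4 + t * c + q') → q = q'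

theorem pairOf_lt : ∀ c < 6, (pairOf c).1 < 4 ∧ (pairOf c).2 < 4 ∧ (pairOf c).1 ≠ (pairOf c).2 := by
  decide

theorem pairOf_inj : ∀ c < 6, ∀ d < 6,
    (∀ l < 4, (l = (pairOf c).1 ∨ l = (pairOf c).2) ↔ (l = (pairOf d).1 ∨ l = (pairOf d).2)) →
    c = d := by
  decide

theorem exists_class_index {i : ℕ} (h4 : 4 ≤ i) (hi : i < 4 + 6 * t) :
    (i - 4) / t < 6 ∧ (i - 4) % t < t ∧ i = 4 + t * ((i - 4) / t) + (i - 4) % t := by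
  have ht : 0 < t := by omega
  refine ⟨?_, Nat.mod_lt _ ht, ?_⟩
  · rw [Nat.div_lt_iff_lt_mul ht]
    omega
  · have := Nat.div_add_mod (i - 4) t
    omega

namespace IsCliqueLabelling

variable (hf : IsCliqueLabelling G S t f)
include hf

theorem adj_clique {i j : ℕ} (hi : i < 4) (hj : j < 4) (hS : G.IsRegularClique 2 S) :
    G.Adj (f i) (f j) ↔ i ≠ j :=
  ⟨fun h e => G.loopless.irrefl (f i) (by rw [e] at h ⊢; exact h),
    fun h => adj_of_mem_clique hS (hf.mem i hi) (hf.mem j hj) fun e => h (hf.inj i hi j hj e)⟩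

theorem mem_class' {i : ℕ} (h4 : 4 ≤ i) (hi : i < 4 + 6 * t) :
    f i ∈ traceClass G S (f (pairOf ((i - 4) / t)).1) (f (pairOf ((i - 4) / t)).2) := by
  obtain ⟨h1, h2, h3⟩ := exists_class_index h4 hi
  have := hf.mem_class _ h1 _ h2
  rwa [← h3] at this

theorem adj_class (hS : G.IsRegularClique 2 S) {i j : ℕ} (h4 : 4 ≤ i) (hi : i < 4 + 6 * t)
    (hj : j < 4) :
    G.Adj (f i) (f j) ↔ j = (pairOf ((i - 4) / t)).1 ∨ j = (pairOf ((i - 4) / t)).2 := by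
  obtain ⟨h1, h2, h3⟩ := pairOf_lt _ (exists_class_index h4 hi).1
  rw [adj_iff_of_mem_traceClass hS (hf.mem _ h1) (hf.mem _ h2) (fun e => h3 (hf.inj _ h1 _ h2 e))
    (hf.mem j hj) (hf.mem_class' h4 hi)]
  exact or_congr ⟨hf.inj j hj _ h1, fun e => by rw [← e]⟩ ⟨hf.inj j hj _ h2, fun e => by rw [← e]⟩

/-- The trace of an outside vertex recovers its class, and inside a class the listing is injective.
-/
theorem injOn (hS : G.IsRegularClique 2 S) : Set.InjOn f (range (4 + 6 * t)) := by
  have key : ∀ i, 4 ≤ i → i < 4 + 6 * t → f i ∉ S := fun i h4 hi =>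
    (mem_traceClass.1 (hf.mem_class' h4 hi)).1
  intro i hi j hj e
  rw [Finset.mem_coe, Finset.mem_range] at hi hj
  rcases Nat.lt_or_ge i 4 with hi4 | hi4 <;> rcases Nat.lt_or_ge j 4 with hj4 | hj4
  · exact hf.inj i hi4 j hj4 e
  · exact absurd (e ▸ hf.mem i hi4) (key j hj4 hj)
  · exact absurd (e ▸ hf.mem j hj4) (key i hi4 hi)
  · obtain ⟨h1, h2, h3⟩ := exists_class_index hi4 hi
    obtain ⟨h1', h2', h3'⟩ := exists_class_index hj4 hj
    have hc : (i - 4) / t = (j - 4) / t := pairOf_inj _ h1 _ h1' fun l hl => by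
      rw [← hf.adj_class hS hi4 hi hl, ← hf.adj_class hS hj4 hj hl, e]
    rw [h3, h3', hc] at e
    rw [h3, h3', hc, hf.inj_class _ h1' _ h2 _ h2' e]

theorem adj_of_knownClique (hS : G.IsRegularClique 2 S) {i j : ℕ} (hi : i < 4 + 6 * t)
    (hj : j < 4 + 6 * t) {c : Bool} (h : knownClique t i j = some c) :
    G.Adj (f i) (f j) ↔ c = true := by
  rw [knownClique] at h
  split_ifs at h with h1 h2 h2 h3
  · rw [hf.adj_clique h1 h2 hS, ← Option.some.inj h]
    simp
  · rw [G.adj_comm, hf.adj_class hS (by omega) hj h1, ← Option.some.inj h]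
    simp
  · rw [hf.adj_class hS (by omega) hi h2, ← Option.some.inj h]
    simp
  · rw [← Option.some.inj h, h3]
    simp

end IsCliqueLabelling

omit [Fintype V] [DecidableEq V] in
theorem exists_enumeration {C : Finset V} (hC : #C = t) [Nonempty V] :
    ∃ p : ℕ → V, (∀ q < t, p q ∈ C) ∧ ∀ q < t, ∀ q' < t, p q = p q' → q = q' := by
  refine ⟨fun q => if h : q < t then ((C.equivFinOfCardEq hC).symm ⟨q, h⟩ : V) else
    Classical.arbitrary V, fun q hq => ?_, fun q hq q' hq' e => ?_⟩
  · simp [hq]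
  · simpa [hq, hq', Subtype.coe_inj] using e

end RowSearch

end SimpleGraph

/-! ### Adjacency between complementary traces on 22 vertices. -/

namespace SimpleGraph

namespace RowSearch

variable {V : Type*} [DecidableEq V] {S : Finset V}

theorem exists_sorted_three {C : Finset V} (hC : #C = 3) (κ : V → ℕ) :
    ∃ x y z, C = {x, y, z} ∧ x ≠ y ∧ x ≠ z ∧ y ≠ z ∧ κ y ≤ κ x ∧ κ z ≤ κ y := by
  obtain ⟨x, y, z, hxy, hxz, hyz, rfl⟩ := Finset.card_eq_three.1 hC
  have e1 : ({x, y, z} : Finset V) = {x, z, y} := by ext; simp; tauto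
  have e2 : ({x, y, z} : Finset V) = {y, x, z} := by ext; simp; tauto
  have e3 : ({x, y, z} : Finset V) = {y, z, x} := by ext; simp; tauto
  have e4 : ({x, y, z} : Finset V) = {z, x, y} := by ext; simp; tauto
  have e5 : ({x, y, z} : Finset V) = {z, y, x} := by ext; simp; tauto
  rcases le_total (κ x) (κ y) with h1 | h1 <;> rcases le_total (κ y) (κ z) with h2 | h2 <;>
    rcases le_total (κ x) (κ z) with h3 | h3
  · exact ⟨z, y, x, e5, hyz.symm, hxz.symm, hxy.symm, h2, h1⟩
  · exact ⟨z, y, x, e5, hyz.symm, hxz.symm, hxy.symm, h2, h1⟩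
  · exact ⟨y, z, x, e3, hyz, hxy.symm, hxz.symm, h2, h3⟩
  · exact ⟨y, x, z, e2, hxy.symm, hyz, hxz, h1, h3⟩
  · exact ⟨z, x, y, e4, hxz.symm, hyz.symm, hxy, h3, h1⟩
  · exact ⟨x, z, y, e1, hxz, hxy, hyz.symm, h3, h2⟩
  · exact ⟨x, y, z, rfl, hxy, hxz, hyz, h1, h2⟩
  · exact ⟨x, y, z, rfl, hxy, hxz, hyz, h1, h2⟩

theorem exists_third {C : Finset V} (hC : #C = 3) {x y : V} (hx : x ∈ C) (hy : y ∈ C)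
    (hxy : x ≠ y) : ∃ z, C = {x, y, z} ∧ z ≠ x ∧ z ≠ y := by
  have h1 : #((C.erase x).erase y) = 1 := by
    rw [Finset.card_erase_of_mem (Finset.mem_erase.2 ⟨hxy.symm, hy⟩), Finset.card_erase_of_mem hx,
      hC]
  obtain ⟨z, hz⟩ := Finset.card_eq_one.1 h1
  have hz' : z ∈ (C.erase x).erase y := by simp [hz]
  rw [Finset.mem_erase, Finset.mem_erase] at hz'
  refine ⟨z, ?_, hz'.2.1, hz'.1⟩
  rw [← Finset.insert_erase hx, ← Finset.insert_erase (Finset.mem_erase.2 ⟨hxy.symm, hy⟩), hz]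

theorem exists_first {C : Finset V} (hC : #C = 3) {z : V} (hz : z ∈ C) (κ : V → ℕ) :
    ∃ x y, C = {x, y, z} ∧ x ≠ y ∧ x ≠ z ∧ y ≠ z ∧ κ y ≤ κ x := by
  have h1 : #(C.erase z) = 2 := by rw [Finset.card_erase_of_mem hz, hC]
  obtain ⟨x, y, hxy, e⟩ := Finset.card_eq_two.1 h1
  have hx : x ∈ C.erase z := by simp [e]
  have hy : y ∈ C.erase z := by simp [e]
  rw [Finset.mem_erase] at hx hy
  have e' : C = {z, x, y} := by rw [← e, Finset.insert_erase hz]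
  rcases le_total (κ y) (κ x) with h | h
  · exact ⟨x, y, by rw [e']; ext; simp; tauto, hxy, hx.1, hy.1, h⟩
  · exact ⟨y, x, by rw [e']; ext; simp; tauto, hxy.symm, hy.1, hx.1, h⟩

/-- A listing of six vertices which satisfies the pattern of type `T`. -/
structure IsPattern (G : SimpleGraph V) (C C' : Finset V) (T : Bool) (p : ℕ → V) : Prop where
  mem : ∀ q < 3, p q ∈ C
  mem' : ∀ q < 3, p (3 + q) ∈ C'
  inj : ∀ a < 6, ∀ b < 6, p a = p b → a = b
  adj : ∀ a < 6, ∀ b < 6, (G.Adj (p a) (p b) ↔ pattern T a b = true)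

variable [Fintype V] {G : SimpleGraph V} [DecidableRel G.Adj] {C C' : Finset V}

theorem inter_erase_eq {x z : V} (hz : z ∈ C) (hxz : ¬ G.Adj x z)
    (h : #C ≤ #(G.neighborFinset x ∩ C) + 1) {y : V} (hy : y ∈ C) (hyz : y ≠ z) : G.Adj x y := by
  have h1 : G.neighborFinset x ∩ C = C.erase z := by
    refine Finset.eq_of_subset_of_card_le (fun y hy => ?_) ?_
    · rw [Finset.mem_inter, mem_neighborFinset] at hy
      exact Finset.mem_erase.2 ⟨fun e => hxz (e ▸ hy.1), hy.2⟩
    · rw [Finset.card_erase_of_mem hz]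
      omega
  have h2 : y ∈ G.neighborFinset x ∩ C := by
    rw [h1]
    exact Finset.mem_erase.2 ⟨hyz, hy⟩
  rw [Finset.mem_inter, mem_neighborFinset] at h2
  exact h2.1

theorem exists_not_adj {x : V} (h : #(G.neighborFinset x ∩ C) < #C) : ∃ z ∈ C, ¬ G.Adj x z := by
  by_contra! h1
  refine absurd (Finset.card_le_card fun z hz => ?_) (not_le.2 h)
  rw [Finset.mem_inter, mem_neighborFinset]
  exact ⟨h1 z hz, hz⟩

theorem adj_of_card_le {x : V} (h : #C ≤ #(G.neighborFinset x ∩ C)) {z : V} (hz : z ∈ C) :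
    G.Adj x z := by
  by_contra h1
  refine absurd (Finset.card_lt_card (s := G.neighborFinset x ∩ C) (t := C) ?_) (not_lt.2 h)
  refine Finset.ssubset_iff_subset_ne.2 ⟨Finset.inter_subset_right, fun e => h1 ?_⟩
  rw [← e, Finset.mem_inter, mem_neighborFinset] at hz
  exact hz.1

theorem not_adj_of_card_eq_zero {x : V} (h : #(G.neighborFinset x ∩ C) = 0) {z : V} (hz : z ∈ C) :
    ¬ G.Adj x z := fun hxz => by
  have : z ∈ G.neighborFinset x ∩ C := Finset.mem_inter.2 ⟨by simpa using hxz, hz⟩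
  rw [Finset.card_eq_zero.1 h] at this
  simp at this

theorem eq_of_card_le_one {x : V} (h : #(G.neighborFinset x ∩ C) ≤ 1) {y z : V} (hy : y ∈ C)
    (hz : z ∈ C) (hxy : G.Adj x y) (hxz : G.Adj x z) : y = z :=
  Finset.card_le_one.1 h y (Finset.mem_inter.2 ⟨by simpa using hxy, hy⟩) z
    (Finset.mem_inter.2 ⟨by simpa using hxz, hz⟩)

/-- Having two more neighbours across than inside leaves at most one inside. The ends `x`, `y` of an
edge in `C` are joined to all of `C'`, and the third vertex `z` misses exactly one `w` there. The
other two vertices of `C'` are joined to all of `C`, hence to each other. -/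
theorem exists_pattern_of_adj (hC : #C = 3) (hC' : #C' = 3) (hd : Disjoint C C')
    (h : ∀ x ∈ C, #(G.neighborFinset x ∩ C') = #(G.neighborFinset x ∩ C) + 2)
    (h' : ∀ x ∈ C', #(G.neighborFinset x ∩ C) = #(G.neighborFinset x ∩ C') + 2)
    {x y : V} (hx : x ∈ C) (hy : y ∈ C) (hxy : G.Adj x y) (κ : V → ℕ) :
    ∃ p : ℕ → V, IsPattern G C C' true p ∧ sortedSix true (fun j => κ (p j)) = true := by
  have hle : ∀ x ∈ C, #(G.neighborFinset x ∩ C) ≤ 1 := fun x hx => by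
    have := Finset.card_le_card (Finset.inter_subset_right (s₁ := G.neighborFinset x) (s₂ := C'))
    have := h x hx
    omega
  have hle' : ∀ x ∈ C', #(G.neighborFinset x ∩ C') ≤ 1 := fun x hx => by
    have := Finset.card_le_card (Finset.inter_subset_right (s₁ := G.neighborFinset x) (s₂ := C))
    have := h' x hx
    omega
  -- The pattern allows exchanging `x` with `y`, and later `u` with `v`; this freedom is spent on
  -- sorting by `κ`.
  wlog hκ : κ y ≤ κ x generalizing x y
  · exact this hy hx hxy.symm (by omega)
  have hpos : ∀ {C : Finset V} {x y : V}, y ∈ C → G.Adj x y → 0 < #(G.neighborFinset x ∩ C) :=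
    fun hy hxy => Finset.card_pos.2 ⟨_, Finset.mem_inter.2 ⟨by simpa using hxy, hy⟩⟩
  obtain ⟨z, rfl, hzx, hzy⟩ := exists_third hC hx hy hxy.ne
  have hz : z ∈ ({x, y, z} : Finset V) := by simp
  have hxz : ¬ G.Adj x z := fun e => hzy (eq_of_card_le_one (hle x hx) hy hz hxy e).symm
  have hyz : ¬ G.Adj y z := fun e => hzx (eq_of_card_le_one (hle y hy) hx hz hxy.symm e).symm
  have hxC : ∀ u ∈ C', G.Adj x u := fun u hu => adj_of_card_le (by
    have := h x hx
    have := hpos hy hxy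
    omega) hu
  have hyC : ∀ u ∈ C', G.Adj y u := fun u hu => adj_of_card_le (by
    have := h y hy
    have := hpos hx hxy.symm
    omega) hu
  have hz0 : #(G.neighborFinset z ∩ {x, y, z}) = 0 := by
    rw [Finset.card_eq_zero, Finset.eq_empty_iff_forall_notMem]
    intro u hu
    simp only [Finset.mem_inter, mem_neighborFinset, Finset.mem_insert, Finset.mem_singleton] at hu
    rcases hu with ⟨h1, rfl | rfl | rfl⟩
    · exact hxz h1.symm
    · exact hyz h1.symm
    · exact G.loopless.irrefl _ h1
  have hz2 := h z hz
  rw [hz0] at hz2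
  obtain ⟨w, hw, hzw⟩ := exists_not_adj (G := G) (x := z) (C := C') (by omega)
  obtain ⟨u, v, rfl, huv, huw, hvw, hκ'⟩ := exists_first hC' hw κ
  have hu : u ∈ ({u, v, w} : Finset V) := by simp
  have hv : v ∈ ({u, v, w} : Finset V) := by simp
  have hzu : G.Adj z u := inter_erase_eq hw hzw (by omega) hu huw
  have hzv : G.Adj z v := inter_erase_eq hw hzw (by omega) hv hvw
  have hw0 : #(G.neighborFinset w ∩ {u, v, w}) = 0 := by
    have h1 := h' w hw
    by_contra h2
    exact hzw (adj_of_card_le (x := w) (C := {x, y, z}) (by omega) hz).symm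
  have hwu := not_adj_of_card_eq_zero hw0 hu
  have hwv := not_adj_of_card_eq_zero hw0 hv
  have huv' : G.Adj u v := by
    have h1 : #({x, y, z} : Finset V) ≤ #(G.neighborFinset u ∩ {x, y, z}) :=
      Finset.card_le_card fun q hq => by
        rw [Finset.mem_inter, mem_neighborFinset]
        refine ⟨?_, hq⟩
        simp only [Finset.mem_insert, Finset.mem_singleton] at hq
        rcases hq with rfl | rfl | rfl
        · exact (hxC u hu).symm
        · exact (hyC u hu).symm
        · exact hzu.symm
    have h2 := h' u hu
    obtain ⟨q, hq⟩ := Finset.card_pos.1 (show 0 < #(G.neighborFinset u ∩ {u, v, w}) by omega)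
    simp only [Finset.mem_inter, mem_neighborFinset, Finset.mem_insert, Finset.mem_singleton] at hq
    rcases hq with ⟨h3, rfl | rfl | rfl⟩
    · exact absurd h3 (G.loopless.irrefl _)
    · exact h3
    · exact absurd h3.symm hwu
  have hne : ∀ a ∈ ({x, y, z} : Finset V), ∀ b ∈ ({u, v, w} : Finset V), a ≠ b := fun a ha b hb =>
    Finset.disjoint_iff_ne.1 hd a ha b hb
  have hxu := hxC u hu
  have hxv := hxC v hv
  have hxw := hxC w hw
  have hyu := hyC u hu
  have hyv := hyC v hv
  have hyw := hyC w hw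
  have hxy' := hxy.ne
  refine ⟨fun a => [x, y, z, u, v, w].getD a x, ⟨?_, ?_, ?_, ?_⟩, ?_⟩
  · intro q hq
    interval_cases q <;> simp
  · intro q hq
    interval_cases q <;> simp
  · have h1 := hne x hx u hu
    have h2 := hne x hx v hv
    have h3 := hne x hx w hw
    have h4 := hne y hy u hu
    have h5 := hne y hy v hv
    have h6 := hne y hy w hw
    have h7 := hne z hz u hu
    have h8 := hne z hz v hv
    have h9 := hne z hz w hw
    intro a ha b hb
    interval_cases a <;> interval_cases b <;>
      simp [hxy', hzx, hzy, huv, huw, hvw, h1, h2, h3, h4, h5, h6, h7, h8, h9, hxy'.symm, hzx.symm,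
        hzy.symm, huv.symm, huw.symm, hvw.symm, h1.symm, h2.symm, h3.symm, h4.symm, h5.symm,
        h6.symm, h7.symm, h8.symm, h9.symm]
  · have g1 := G.adj_comm z x
    have g2 := G.adj_comm z y
    have g3 := G.adj_comm w z
    have g4 := G.adj_comm u w
    have g5 := G.adj_comm v w
    intro a ha b hb
    interval_cases a <;> interval_cases b <;>
      simp [pattern, hxy, hxy.symm, hxz, hyz, hxu, hxv, hxw, hyu, hyv, hyw, hzu, hzv, hzw, huv',
        hwu, hwv, hxu.symm, hxv.symm, hxw.symm, hyu.symm, hyv.symm, hyw.symm, hzu.symm, hzv.symm,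
        huv'.symm, g1, g2, g3, g4, g5]
  · simp [sortedSix, hκ, hκ']

/-- There are six cross edges, which leaves no edge inside `C'`. Each vertex then misses exactly one
vertex across, so the cross edges are all pairs except a perfect matching `g`. -/
theorem exists_pattern_of_not_adj (hC : #C = 3) (hC' : #C' = 3) (hd : Disjoint C C')
    (h : ∀ x ∈ C, #(G.neighborFinset x ∩ C') = #(G.neighborFinset x ∩ C) + 2)
    (h' : ∀ x ∈ C', #(G.neighborFinset x ∩ C) = #(G.neighborFinset x ∩ C') + 2)
    (hadj : ∀ x ∈ C, ∀ y ∈ C, ¬ G.Adj x y) (κ : V → ℕ) :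
    ∃ p : ℕ → V, IsPattern G C C' false p ∧ sortedSix false (fun j => κ (p j)) = true := by
  have h0 : ∀ x ∈ C, #(G.neighborFinset x ∩ C) = 0 := fun x hx => by
    rw [Finset.card_eq_zero, Finset.eq_empty_iff_forall_notMem]
    intro y hy
    rw [Finset.mem_inter, mem_neighborFinset] at hy
    exact hadj x hx y hy.2 hy.1
  have hsum := sum_card_inter_comm (G := G) C C'
  rw [Finset.sum_congr rfl fun x hx => (h x hx).trans (by rw [h0 x hx, zero_add]),
    Finset.sum_congr rfl h', Finset.sum_add_distrib, Finset.sum_const, Finset.sum_const, hC, hC',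
    smul_eq_mul] at hsum
  have h0' : ∀ x ∈ C', #(G.neighborFinset x ∩ C') = 0 := by
    have : ∑ x ∈ C', #(G.neighborFinset x ∩ C') = 0 := by omega
    exact Finset.sum_eq_zero_iff.1 this
  have h2 : ∀ x ∈ C, #(G.neighborFinset x ∩ C') = 2 := fun x hx => by rw [h x hx, h0 x hx]
  have h2' : ∀ x ∈ C', #(G.neighborFinset x ∩ C) = 2 := fun x hx => by rw [h' x hx, h0' x hx]
  have hg : ∀ x, ∃ u, x ∈ C → u ∈ C' ∧ ¬ G.Adj x u := fun x => by
    by_cases hx : x ∈ C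
    · obtain ⟨u, hu⟩ := exists_not_adj (G := G) (x := x) (C := C') (by rw [h2 x hx]; omega)
      exact ⟨u, fun _ => hu⟩
    · exact ⟨x, fun h => absurd h hx⟩
  choose g hg using hg
  -- The matched pairs can be permuted freely; for weights `0` and `1` this key orders them
  -- lexicographically.
  obtain ⟨x, y, z, hxyz, hxy, hxz, hyz, hκ1, hκ2⟩ :=
    exists_sorted_three hC fun x => 2 * κ x + κ (g x)
  have hx : x ∈ C := by simp [hxyz]
  have hy : y ∈ C := by simp [hxyz]
  have hz : z ∈ C := by simp [hxyz]
  have hinj : ∀ a ∈ C, ∀ b ∈ C, a ≠ b → g a ≠ g b := fun a ha b hb hab e => by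
    have h1 : G.Adj (g a) b := inter_erase_eq ha (fun h => (hg a ha).2 h.symm)
      (by rw [hC, h2' _ (hg a ha).1]) hb hab.symm
    exact (hg b hb).2 (e ▸ h1.symm)
  have hcross : ∀ a ∈ C, ∀ b ∈ C, a ≠ b → G.Adj a (g b) := fun a ha b hb hab =>
    inter_erase_eq (C := C') (hg a ha).1 (hg a ha).2 (by rw [hC', h2 a ha]) (hg b hb).1
      (hinj b hb a ha hab.symm)
  have hne : ∀ a ∈ C, ∀ b ∈ C, a ≠ g b := fun a ha b hb =>
    Finset.disjoint_iff_ne.1 hd a ha _ (hg b hb).1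
  have hC'' : ∀ a ∈ C, ∀ b ∈ C, ¬ G.Adj (g a) (g b) := fun a ha b hb =>
    not_adj_of_card_eq_zero (h0' _ (hg a ha).1) (hg b hb).1
  have hl : ∀ q < 3, [x, y, z].getD q x ∈ C := fun q hq => by
    interval_cases q
    · exact hx
    · exact hy
    · exact hz
  have hlinj : ∀ q < 3, ∀ q' < 3, [x, y, z].getD q x = [x, y, z].getD q' x → q = q' := by
    intro q hq q' hq'
    interval_cases q <;> interval_cases q' <;>
      simp [hxy, hxz, hyz, hxy.symm, hxz.symm, hyz.symm]
  refine ⟨fun a => if a < 3 then [x, y, z].getD a x else g ([x, y, z].getD (a - 3) x),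
    ⟨?_, ?_, ?_, ?_⟩, ?_⟩
  · intro q hq
    simp only [hq, if_true]
    exact hl q hq
  · intro q hq
    simp only [show ¬ 3 + q < 3 by omega, if_false, Nat.add_sub_cancel_left]
    exact (hg _ (hl q hq)).1
  · intro a ha b hb e
    by_cases ha3 : a < 3 <;> by_cases hb3 : b < 3 <;> simp only [ha3, hb3, if_true, if_false] at e
    · exact hlinj a ha3 b hb3 e
    · exact absurd e (hne _ (hl a ha3) _ (hl _ (by omega)))
    · exact absurd e.symm (hne _ (hl b hb3) _ (hl _ (by omega)))
    · by_contra hab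
      refine hinj _ (hl (a - 3) (by omega)) _ (hl (b - 3) (by omega)) (fun e' => hab ?_) e
      have := hlinj _ (by omega) _ (by omega) e'
      omega
  · have key : ∀ a < 3, ∀ b < 3, (G.Adj ([x, y, z].getD a x) (g ([x, y, z].getD b x)) ↔ a ≠ b) :=
      fun a ha b hb => by
        constructor
        · rintro h1 rfl
          exact (hg _ (hl a ha)).2 h1
        · exact fun h1 => hcross _ (hl a ha) _ (hl b hb) fun e => h1 (hlinj a ha b hb e)
    intro a ha b hb
    by_cases ha3 : a < 3 <;> by_cases hb3 : b < 3 <;> simp only [ha3, hb3, if_true, if_false]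
    · have : pattern false a b = false := by
        have h1 : a / 3 = b / 3 := by omega
        simp [pattern, h1]
      rw [this]
      simpa using hadj _ (hl a ha3) _ (hl b hb3)
    · have h1 : ¬ a / 3 = b / 3 := by omega
      rw [key a ha3 _ (by omega)]
      simp only [pattern, h1, if_false, Bool.false_eq_true, bne_iff_ne]
      omega
    · have h1 : ¬ a / 3 = b / 3 := by omega
      rw [G.adj_comm, key b hb3 _ (by omega)]
      simp only [pattern, h1, if_false, Bool.false_eq_true, bne_iff_ne]
      omega
    · have : pattern false a b = false := by
        have h1 : a / 3 = b / 3 := by omega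
        simp [pattern, h1]
      rw [this]
      simpa using hC'' _ (hl _ (by omega)) _ (hl _ (by omega))
  · simp [sortedSix, hκ1, hκ2]

theorem exists_pattern (hC : #C = 3) (hC' : #C' = 3) (hd : Disjoint C C')
    (h : ∀ x ∈ C, #(G.neighborFinset x ∩ C') = #(G.neighborFinset x ∩ C) + 2)
    (h' : ∀ x ∈ C', #(G.neighborFinset x ∩ C) = #(G.neighborFinset x ∩ C') + 2)
    {T : Bool} (hT : T = true ↔ ∃ x ∈ C, ∃ y ∈ C, G.Adj x y) (κ : V → ℕ) :
    ∃ p : ℕ → V, IsPattern G C C' T p ∧ sortedSix T (fun j => κ (p j)) = true := by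
  cases T
  · refine exists_pattern_of_not_adj hC hC' hd h h' (fun x hx y hy hxy => ?_) κ
    exact Bool.false_ne_true (hT.2 ⟨x, hx, y, hy, hxy⟩)
  · obtain ⟨x, hx, y, hy, hxy⟩ := hT.1 rfl
    exact exists_pattern_of_adj hC hC' hd h h' hx hy hxy κ

end RowSearch

end SimpleGraph

/-! ### Nonexistence on 22 vertices. -/

namespace SimpleGraph

namespace RowSearch

variable {V : Type*} [Fintype V] [DecidableEq V] {G : SimpleGraph V} [DecidableRel G.Adj]
  {n k ℓ t p q : ℕ} {S : Finset V} {a b c d : V}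

theorem card_traceClass (hG : G.IsEdgeRegularWith n k ℓ) (hS : G.IsRegularClique 2 S)
    (ht : t + #S = ℓ + 2) (ha : a ∈ S) (hb : b ∈ S) (hab : a ≠ b) : #(traceClass G S a b) = t :=
  card_common_compl hG hS ht ha hb hab

theorem mem_traceClass_iff_not_adj (hS : G.IsRegularClique 2 S) (h : S = {a, b, c, d})
    (hac : a ≠ c) (had : a ≠ d) (hbc : b ≠ c) (hbd : b ≠ d) (hcd : c ≠ d) {x : V} :
    x ∈ traceClass G S c d ↔ x ∉ S ∧ ¬ G.Adj x a ∧ ¬ G.Adj x b := by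
  have ha : a ∈ S := by simp [h]
  have hb : b ∈ S := by simp [h]
  have hc : c ∈ S := by simp [h]
  have hd : d ∈ S := by simp [h]
  constructor
  · intro hx
    refine ⟨(mem_traceClass.1 hx).1, ?_, ?_⟩
    · rw [adj_iff_of_mem_traceClass hS hc hd hcd ha hx]
      tauto
    · rw [adj_iff_of_mem_traceClass hS hc hd hcd hb hx]
      tauto
  · rintro ⟨hxS, hxa, hxb⟩
    have h1 : G.neighborFinset x ∩ S = {c, d} := by
      refine Finset.eq_of_subset_of_card_le (fun y hy => ?_) ?_
      · rw [Finset.mem_inter, mem_neighborFinset, h] at hy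
        simp only [Finset.mem_insert, Finset.mem_singleton] at hy ⊢
        rcases hy with ⟨h1, rfl | rfl | h2⟩
        · exact absurd h1 hxa
        · exact absurd h1 hxb
        · exact h2
      · rw [card_nexus hS hxS, Finset.card_pair hcd]
    have h2 : ∀ y ∈ ({c, d} : Finset V), G.Adj x y := fun y hy => by
      rw [← h1, Finset.mem_inter, mem_neighborFinset] at hy
      exact hy.1
    exact mem_traceClass.2 ⟨hxS, h2 c (by simp), h2 d (by simp)⟩

/-- A vertex outside the clique has `k - 2 * ℓ` more neighbours with the opposite trace than with its own
trace. -/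
theorem card_nbr_opposite (hG : G.IsEdgeRegularWith n k ℓ) (hS : G.IsRegularClique 2 S)
    (h : S = {a, b, c, d}) (hac : a ≠ c) (had : a ≠ d) (hbc : b ≠ c) (hbd : b ≠ d)
    (hcd : c ≠ d) {e : ℕ} (he : e + 2 * ℓ = k) {x : V} (hx : x ∈ traceClass G S a b) :
    #(G.neighborFinset x ∩ traceClass G S c d) = #(G.neighborFinset x ∩ traceClass G S a b) + e := by
  have ha : a ∈ S := by simp [h]
  have hb : b ∈ S := by simp [h]
  obtain ⟨hxS, hxa, hxb⟩ := mem_traceClass.1 hx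
  have hpos : 0 < ℓ := by
    rw [← hG.card_common hxa, Finset.card_pos]
    have h2 : (G.neighborFinset x ∩ S).Nonempty := ⟨b, by simp [hxb, hb]⟩
    by_cases hab : a = b
    · subst hab
      have h3 : 1 < #(G.neighborFinset x ∩ S) := by rw [card_nexus hS hxS]; omega
      obtain ⟨y, hy, hya⟩ := Finset.exists_mem_ne h3 a
      rw [Finset.mem_inter] at hy
      exact ⟨y, Finset.mem_inter.2 ⟨hy.1, by
        simpa using adj_of_mem_clique hS ha hy.2 hya.symm⟩⟩
    · exact ⟨b, by simp [hxb, adj_of_mem_clique hS ha hb hab]⟩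
  obtain ⟨r, hr⟩ : ∃ r, r + 2 = ℓ + 1 := ⟨ℓ - 1, by omega⟩
  have h1 := card_nbr_inter_compl hG hS hxS
  have h2 := card_common_compl_of_notMem hG hS hr hxS ha hxa
  have h3 := card_common_compl_of_notMem hG hS hr hxS hb hxb
  -- Inclusion and exclusion on the `k - 2` outside neighbours of `x`: `ℓ - 1` are adjacent to `a`,
  -- `ℓ - 1` to `b`, those adjacent to both share the trace of `x`, and those adjacent to neither
  -- have the opposite trace.
  have h4 := Finset.card_union_add_card_inter (G.neighborFinset x ∩ G.neighborFinset a ∩ Sᶜ)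
    (G.neighborFinset x ∩ G.neighborFinset b ∩ Sᶜ)
  have h5 : G.neighborFinset x ∩ G.neighborFinset a ∩ Sᶜ ∩
      (G.neighborFinset x ∩ G.neighborFinset b ∩ Sᶜ) = G.neighborFinset x ∩ traceClass G S a b := by
    ext y
    simp only [Finset.mem_inter, traceClass]
    tauto
  have h6 : G.neighborFinset x ∩ traceClass G S c d = (G.neighborFinset x ∩ Sᶜ) \
      (G.neighborFinset x ∩ G.neighborFinset a ∩ Sᶜ ∪
        G.neighborFinset x ∩ G.neighborFinset b ∩ Sᶜ) := by
    ext y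
    rw [Finset.mem_inter, mem_traceClass_iff_not_adj hS h hac had hbc hbd hcd]
    simp only [Finset.mem_sdiff, Finset.mem_union, Finset.mem_inter, mem_neighborFinset,
      Finset.mem_compl, G.adj_comm y]
    tauto
  have h7 : G.neighborFinset x ∩ G.neighborFinset a ∩ Sᶜ ∪
      G.neighborFinset x ∩ G.neighborFinset b ∩ Sᶜ ⊆ G.neighborFinset x ∩ Sᶜ := by
    intro y
    simp only [Finset.mem_union, Finset.mem_inter]
    tauto
  have h8 := Finset.card_le_card h7
  rw [h6, Finset.card_sdiff_of_subset h7]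
  rw [h5] at h4
  omega

-- Fixing one clique vertex and sorting the other three by `P` reduces the eight combinations of
-- types to four.
omit [Fintype V] in
theorem exists_clique_order (hS : #S = 4) (P : V → V → Prop) :
    ∃ (s : ℕ → V) (r : ℕ), r ≤ 3 ∧ (∀ i < 4, s i ∈ S) ∧
      (∀ i < 4, ∀ j < 4, s i = s j → i = j) ∧
      ∀ c < 3, (typesOf r c = true ↔ P (s (pairOf (2 * c)).1) (s (pairOf (2 * c)).2)) := by
  classical
  obtain ⟨a, ha⟩ := Finset.card_pos.1 (show 0 < #S by omega)
  obtain ⟨x, y, z, h, hxy, hxz, hyz, h1, h2⟩ := exists_sorted_three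
    (show #(S.erase a) = 3 by rw [Finset.card_erase_of_mem ha, hS])
    (fun v => if P a v then 1 else 0)
  have hx : x ∈ S.erase a := by simp [h]
  have hy : y ∈ S.erase a := by simp [h]
  have hz : z ∈ S.erase a := by simp [h]
  rw [Finset.mem_erase] at hx hy hz
  refine ⟨fun i => [a, x, y, z].getD i a, (if P a x then 1 else 0) + (if P a y then 1 else 0) +
    (if P a z then 1 else 0), ?_, fun i hi => ?_, fun i hi j hj => ?_, fun c hc => ?_⟩
  · split_ifs <;> omega
  · interval_cases i
    · exact ha
    · exact hx.2
    · exact hy.2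
    · exact hz.2
  · interval_cases i <;> interval_cases j <;>
      simp [hxy, hxz, hyz, hxy.symm, hxz.symm, hyz.symm, hx.1, hy.1, hz.1, hx.1.symm, hy.1.symm,
        hz.1.symm]
  · have e0 : pairOf (2 * 0) = (0, 1) := rfl
    have e1 : pairOf (2 * 1) = (0, 2) := rfl
    have e2 : pairOf (2 * 2) = (0, 3) := rfl
    interval_cases c <;> simp only [typesOf, decide_eq_true_eq, e0, e1, e2] <;>
      by_cases p1 : P a x <;> by_cases p2 : P a y <;> by_cases p3 : P a z <;>
      simp_all

omit [Fintype V] in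
theorem eq_insert_of_card_eq_four (hS : #S = 4) {s : ℕ → V} (hmem : ∀ i < 4, s i ∈ S)
    (hinj : ∀ i < 4, ∀ j < 4, s i = s j → i = j) {i j i' j' : ℕ} (hi : i < 4) (hj : j < 4)
    (hi' : i' < 4) (hj' : j' < 4) (h : [i, j, i', j'].Nodup) :
    S = {s i, s j, s i', s j'} := by
  symm
  refine Finset.eq_of_subset_of_card_le ?_ ?_
  · intro y hy
    simp only [Finset.mem_insert, Finset.mem_singleton] at hy
    rcases hy with rfl | rfl | rfl | rfl
    · exact hmem _ hi
    · exact hmem _ hj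
    · exact hmem _ hi'
    · exact hmem _ hj'
  · have hne : ∀ {a b}, a < 4 → b < 4 → a ≠ b → s a ≠ s b := fun ha hb h e => h (hinj _ ha _ hb e)
    simp only [List.nodup_cons, List.mem_cons, List.not_mem_nil, or_false, not_or] at h
    rw [hS, Finset.card_insert_of_notMem, Finset.card_insert_of_notMem, Finset.card_pair]
    · exact hne hi' hj' h.2.2.1
    · simp only [Finset.mem_insert, Finset.mem_singleton, not_or]
      exact ⟨hne hj hi' h.2.1.1, hne hj hj' h.2.1.2⟩
    · simp only [Finset.mem_insert, Finset.mem_singleton, not_or]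
      exact ⟨hne hi hj h.1.1, hne hi hi' h.1.2.1, hne hi hj' h.1.2.2⟩

theorem pairOf_nodup : ∀ c < 3, [(pairOf (2 * c)).1, (pairOf (2 * c)).2, (pairOf (2 * c + 1)).1,
    (pairOf (2 * c + 1)).2].Nodup := by
  decide

/-- In a graph with parameters `(22, 12, 5)` and a `2`-regular clique of size four, each pair of
complementary traces gives a pattern. -/
theorem exists_pattern_traceClass (hG : G.IsEdgeRegularWith 22 12 5) (hS : G.IsRegularClique 2 S)
    (hS4 : #S = 4) {s : ℕ → V} (hmem : ∀ i < 4, s i ∈ S)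
    (hinj : ∀ i < 4, ∀ j < 4, s i = s j → i = j) {i j i' j' : ℕ} (hi : i < 4) (hj : j < 4)
    (hi' : i' < 4) (hj' : j' < 4) (hnd : [i, j, i', j'].Nodup) {T : Bool}
    (hT : T = true ↔ ∃ x ∈ traceClass G S (s i) (s j), ∃ y ∈ traceClass G S (s i) (s j), G.Adj x y)
    (κ : V → ℕ) :
    ∃ p : ℕ → V, IsPattern G (traceClass G S (s i) (s j)) (traceClass G S (s i') (s j')) T p ∧
      sortedSix T (fun j => κ (p j)) = true := by
  have hne : ∀ {a b}, a < 4 → b < 4 → a ≠ b → s a ≠ s b := fun ha hb h e => h (hinj _ ha _ hb e)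
  have h1 := eq_insert_of_card_eq_four hS4 hmem hinj hi hj hi' hj' hnd
  simp only [List.nodup_cons, List.mem_cons, List.not_mem_nil, or_false, not_or] at hnd
  obtain ⟨⟨hij, hii', hij'⟩, ⟨hji', hjj'⟩, hij'', -⟩ := hnd
  have h2 := eq_insert_of_card_eq_four hS4 hmem hinj hi' hj' hi hj (by
    simp [hij, Ne.symm hii', Ne.symm hij', Ne.symm hji', Ne.symm hjj', hij''])
  have ht : 3 + #S = 5 + 2 := by rw [hS4]
  refine exists_pattern (card_traceClass hG hS ht (hmem i hi) (hmem j hj) (hne hi hj hij))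
    (card_traceClass hG hS ht (hmem i' hi') (hmem j' hj') (hne hi' hj' hij''))
    (Finset.disjoint_left.2 fun x hx hx' => ?_) (fun x hx => ?_) (fun x hx => ?_) hT κ
  · exact ((mem_traceClass_iff_not_adj hS h1 (hne hi hi' hii') (hne hi hj' hij')
      (hne hj hi' hji') (hne hj hj' hjj') (hne hi' hj' hij'')).1 hx').2.1
      (mem_traceClass.1 hx).2.1
  · exact card_nbr_opposite hG hS h1 (hne hi hi' hii') (hne hi hj' hij')
      (hne hj hi' hji') (hne hj hj' hjj') (hne hi' hj' hij'') (by norm_num) hx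
  · exact card_nbr_opposite hG hS h2 (hne hi hi' hii').symm (hne hj hi' hji').symm
      (hne hi hj' hij').symm (hne hj hj' hjj').symm (hne hi hj hij) (by norm_num) hx

theorem search_typesOf {r : ℕ} (hr : r ≤ 3) :
    search (fun _ => false) 5 23 (domains (typesOf r)) [] = true := by
  interval_cases r
  · exact search_types_zero
  · exact search_types_one
  · exact search_types_two
  · exact search_types_three

/-- The vertices listed by `s`, followed by three listings of six vertices. -/
def combine (s p₀ p₁ p₂ : ℕ → V) (i : ℕ) : V :=
  if i < 4 then s i
  else if (i - 4) / 6 = 0 then p₀ ((i - 4) % 6)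
  else if (i - 4) / 6 = 1 then p₁ ((i - 4) % 6) else p₂ ((i - 4) % 6)

omit [Fintype V] [DecidableEq V] in
theorem combine_of_lt {s p₀ p₁ p₂ : ℕ → V} {i : ℕ} (hi : i < 4) : combine s p₀ p₁ p₂ i = s i :=
  if_pos hi

end RowSearch

open RowSearch

variable {V : Type*} [Fintype V] [DecidableEq V] {G : SimpleGraph V} [DecidableRel G.Adj]
  {S : Finset V}

theorem not_isRegularClique_of_card_eq_22 (hG : G.IsEdgeRegularWith 22 12 5)
    (hS : G.IsRegularClique 2 S) (hS4 : #S = 4) : False := by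
  obtain ⟨s, r, hr, hmem, hinj, hT⟩ := exists_clique_order hS4 fun a b =>
    ∃ x ∈ traceClass G S a b, ∃ y ∈ traceClass G S a b, G.Adj x y
  have key := fun c (hc : c < 3) => exists_pattern_traceClass hG hS hS4 hmem hinj
    (pairOf_lt (2 * c) (by omega)).1 (pairOf_lt (2 * c) (by omega)).2.1
    (pairOf_lt (2 * c + 1) (by omega)).1 (pairOf_lt (2 * c + 1) (by omega)).2.1 (pairOf_nodup c hc)
    (hT c hc)
  -- The first block is listed without normalization; its vertex `p₀ 2`, which receives label `6`,
  -- then provides the weights that sort the other two.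
  obtain ⟨p₀, hp₀, -⟩ := key 0 (by omega) fun _ => 0
  obtain ⟨p₁, hp₁, hs₁⟩ := key 1 (by omega) fun v => (decide (G.Adj (p₀ 2) v)).toNat
  obtain ⟨p₂, hp₂, hs₂⟩ := key 2 (by omega) fun v => (decide (G.Adj (p₀ 2) v)).toNat
  set f := combine s p₀ p₁ p₂ with hf
  have f0 : ∀ a < 6, f (4 + a) = p₀ a := fun a ha => by
    interval_cases a <;> rfl
  have f1 : ∀ a < 6, f (10 + a) = p₁ a := fun a ha => by
    interval_cases a <;> rfl
  have f2 : ∀ a < 6, f (16 + a) = p₂ a := fun a ha => by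
    interval_cases a <;> rfl
  have hlab : IsCliqueLabelling G S 3 f := by
    refine ⟨fun i hi => ?_, fun i hi j hj => ?_, fun c hc q hq => ?_, fun c hc q hq q' hq' => ?_⟩
    · rw [hf, combine_of_lt hi]
      exact hmem i hi
    · rw [hf, combine_of_lt hi, combine_of_lt hj]
      exact hinj i hi j hj
    · obtain ⟨h1, h2, -⟩ := pairOf_lt c hc
      rw [show f (pairOf c).1 = s (pairOf c).1 from combine_of_lt h1,
        show f (pairOf c).2 = s (pairOf c).2 from combine_of_lt h2]
      interval_cases c
      · have := hp₀.mem q hq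
        rwa [← f0 q (by omega)] at this
      · have := hp₀.mem' q hq
        rwa [← f0 (3 + q) (by omega), ← add_assoc] at this
      · have := hp₁.mem q hq
        rwa [← f1 q (by omega)] at this
      · have := hp₁.mem' q hq
        rwa [← f1 (3 + q) (by omega), ← add_assoc] at this
      · have := hp₂.mem q hq
        rwa [← f2 q (by omega)] at this
      · have := hp₂.mem' q hq
        rwa [← f2 (3 + q) (by omega), ← add_assoc] at this
    · intro e
      have h0 : ∀ c < 6, ∃ a, a + 3 ≤ 6 ∧ ((∀ q < 3, f (4 + 3 * c + q) = p₀ (a + q)) ∨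
          (∀ q < 3, f (4 + 3 * c + q) = p₁ (a + q)) ∨ ∀ q < 3, f (4 + 3 * c + q) = p₂ (a + q)) := by
        intro c hc
        refine ⟨3 * (c % 2), by omega, ?_⟩
        interval_cases c
        · exact Or.inl fun q hq => by interval_cases q <;> rfl
        · exact Or.inl fun q hq => by interval_cases q <;> rfl
        · exact Or.inr (Or.inl fun q hq => by interval_cases q <;> rfl)
        · exact Or.inr (Or.inl fun q hq => by interval_cases q <;> rfl)
        · exact Or.inr (Or.inr fun q hq => by interval_cases q <;> rfl)
        · exact Or.inr (Or.inr fun q hq => by interval_cases q <;> rfl)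
      obtain ⟨a, ha, h1 | h1 | h1⟩ := h0 c hc <;> rw [h1 q hq, h1 q' hq'] at e
      · have := hp₀.inj _ (by omega) _ (by omega) e
        omega
      · have := hp₁.inj _ (by omega) _ (by omega) e
        omega
      · have := hp₂.inj _ (by omega) _ (by omega) e
        omega
  have hinjOn : Set.InjOn f (range 22) := hlab.injOn hS
  have hadj : ∀ i < 22, ∀ j < 22, ∀ c, knownPattern (typesOf r) i j = some c →
      (G.Adj (f i) (f j) ↔ c = true) := by
    intro i hi j hj c h
    rw [knownPattern] at h
    split_ifs at h with h1
    · obtain ⟨h1, h2, h3⟩ := h1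
      have hi6 : (i - 4) % 6 < 6 := Nat.mod_lt _ (by norm_num)
      have hj6 : (j - 4) % 6 < 6 := Nat.mod_lt _ (by norm_num)
      have hfi : ¬ i < 4 := by omega
      have hfj : ¬ j < 4 := by omega
      have hq : (j - 4) / 6 < 3 := by omega
      rw [hf, combine, combine, if_neg hfi, if_neg hfj, ← Option.some.inj h, h3]
      generalize (j - 4) / 6 = m at hq
      interval_cases m
      · exact hp₀.adj _ hi6 _ hj6
      · exact hp₁.adj _ hi6 _ hj6
      · exact hp₂.adj _ hi6 _ hj6
    · exact hlab.adj_of_knownClique hS hi hj h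
  have hf6 : f 6 = p₀ 2 := rfl
  -- The weights on a block are digits of row `6`, so the normalization filters the domain of that
  -- single row.
  have hsort : ∀ {T : Bool} {b : ℕ} {p : ℕ → V}, b + 6 ≤ 22 → (∀ a < 6, f (b + a) = p a) →
      sortedSix T (fun j => (decide (G.Adj (p₀ 2) (p j))).toNat) = true →
      sortedAt T b (adjRow G f 22 6) = true := by
    intro T b p hb hfp h
    have h1 : ∀ a < 6, (adjRow G f 22 6).testBit (b + a) = decide (G.Adj (p₀ 2) (p a)) :=
      fun a ha => by rw [testBit_adjRow (by omega), hf6, hfp a ha]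
    rw [← h]
    simp only [sortedAt, sortedSix, h1 0 (by omega), h1 1 (by omega), h1 2 (by omega),
      h1 3 (by omega), h1 4 (by omega), h1 5 (by omega)]
  have hdom : InDomains 22 (adjRow G f 22) (domains (typesOf r)) := by
    intro x hx
    obtain ⟨i, hi, rfl⟩ := List.mem_map.1 hx
    rw [List.mem_range] at hi
    refine ⟨hi, List.mem_filter.2 ⟨adjRow_mem_rowsOf hG hinjOn (hadj i hi), ?_⟩⟩
    by_cases h6 : i = 6
    · subst h6
      rw [hsort (by omega) f1 hs₁, hsort (by omega) f2 hs₂]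
      rfl
    · simp [h6]
  obtain ⟨asg, h, -⟩ := of_search (isRowSystem_adjRow hG hinjOn (by norm_num)) _ _ _ [] hdom
    (by simp) (search_typesOf hr)
  exact Bool.false_ne_true h

end SimpleGraph

/-! ### The search on 16 vertices. -/

namespace SimpleGraph

namespace RowSearch

/-- The rows of the adjacency matrix of `neumaierGraph`. -/
def neumaierRow (i : ℕ) : ℕ :=
  [13118, 52285, 50123, 15559, 50147, 15571, 13244, 52348, 62549, 63573, 61866, 62122, 20329, 36713,
    8086, 12182].getD i 0

/-- Rotate the three pairs of complementary traces `r` times, and exchange the two vertices in the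
classes selected by `w`. -/
def relabel (r : ℕ) (w : ℕ → Bool) (i : ℕ) : ℕ :=
  if i = 0 then 0
  else if i < 4 then (i - 1 + r) % 3 + 1
  else 4 + 2 * (((i - 4) / 2 + 2 * r) % 6) + ((i - 4) % 2 ^^^ (w ((i - 4) / 2)).toNat)

/-- Exchange the vertices in some of the classes `0`, `1`, `2` and `4`. -/
def exchange (a b c d : Bool) (i : ℕ) : Bool := [a, b, c, false, d, false].getD i false

/-- Whether the rows `r` are those of a graph in which nonadjacent vertices have six common
neighbours. -/
def isRegularRows (r : ℕ → ℕ) : Bool :=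
  (List.range 16).all fun i => (List.range 16).all fun j =>
    Nat.beq i j || (r i).testBit j || Nat.beq (popcount (Nat.land (r i) (r j))) 6

/-- Whether the rows `r`, relabelled by `s`, are the rows of `neumaierGraph`. -/
def isNeumaierRows (r s : ℕ → ℕ) : Bool :=
  (List.range 16).all fun i => (List.range 16).all fun j =>
    (r (s i)).testBit (s j) == (neumaierRow i).testBit j

/-- Whether the rows `r`, after some relabelling, are the rows of `neumaierGraph`. -/
def existsNeumaierRows (r : ℕ → ℕ) : Bool :=
  [0, 1, 2].any fun k => [false, true].any fun a => [false, true].any fun b =>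
    [false, true].any fun c => [false, true].any fun d =>
      isNeumaierRows r (relabel k (exchange a b c d))

/-- The row of `i` in a full assignment. -/
def lookupRow (asg : List (ℕ × ℕ)) (i : ℕ) : ℕ := (asg.lookup i).getD 0

/-- The condition on the solutions of the search for graphs on `16` vertices. -/
def isSolution (asg : List (ℕ × ℕ)) : Bool :=
  (List.range 16).all (fun i => (asg.lookup i).isSome) &&
    (isRegularRows (lookupRow asg) || existsNeumaierRows (lookupRow asg))

/-- The domains of the rows in the search for graphs on `16` vertices. -/
noncomputable def domains16 : List (ℕ × List ℕ) :=
  (List.range 16).map fun i => (i, rowsOf (knownClique 2 i) 9 16)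

set_option maxRecDepth 100000 in
theorem search_domains16 : search isSolution 4 17 domains16 [] = true := by
  decide +kernel

end RowSearch

end SimpleGraph

/-! ### The strictly Neumaier graph on 16 vertices and its uniqueness. -/

namespace SimpleGraph

open RowSearch

/-- The strictly Neumaier graph on `16` vertices. -/
def neumaierGraph : SimpleGraph (Fin 16) where
  Adj i j := (neumaierRow i).testBit j = true
  symm := ⟨by decide +kernel⟩
  loopless := ⟨by decide +kernel⟩

instance : DecidableRel neumaierGraph.Adj := fun i j =>
  inferInstanceAs (Decidable ((neumaierRow i).testBit j = true))

theorem neumaierGraph_card_common (x y : Fin 16) :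
    Fintype.card (neumaierGraph.commonNeighbors x y) =
      #{z | neumaierGraph.Adj x z ∧ neumaierGraph.Adj y z} := by
  rw [card_commonNeighbors_eq]
  congr 1
  ext z
  simp

theorem neumaierGraph_ne_top : neumaierGraph ≠ ⊤ := fun h => by
  have h1 : ¬ neumaierGraph.Adj 0 6 := by decide +kernel
  rw [h, top_adj] at h1
  exact h1 (by decide)

theorem neumaierGraph_isEdgeRegularWith : neumaierGraph.IsEdgeRegularWith 16 9 4 where
  nonempty h := by
    have h1 : neumaierGraph.Adj 0 1 := by decide +kernel
    rw [h] at h1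
    exact h1
  card := rfl
  regular x := by
    have h : ∀ x : Fin 16, #{z | neumaierGraph.Adj x z} = 9 := by decide +kernel
    rw [← h x, ← card_neighborFinset_eq_degree]
    congr 1
    ext z
    simp
  of_adj x y h := by
    have h1 : ∀ x y : Fin 16, neumaierGraph.Adj x y →
        #{z | neumaierGraph.Adj x z ∧ neumaierGraph.Adj y z} = 4 := by decide +kernel
    rw [neumaierGraph_card_common, h1 x y h]

theorem neumaierGraph_isRegularClique : neumaierGraph.IsRegularClique 2 {0, 1, 2, 3} where
  clique := by
    have h : ∀ x ∈ ({0, 1, 2, 3} : Finset (Fin 16)), ∀ y ∈ ({0, 1, 2, 3} : Finset (Fin 16)),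
        x ≠ y → neumaierGraph.Adj x y := by decide +kernel
    exact fun x hx y hy => h x hx y hy
  pos := by norm_num
  nexus := by decide +kernel

/-- Vertex `0` has eight common neighbours with its non-neighbour `6`, but four with its
non-neighbour `7`. -/
theorem neumaierGraph_not_isStronglyRegular : ¬ neumaierGraph.IsStronglyRegular := by
  rintro ⟨-, -, n, k, ℓ, μ, h⟩
  have h1 : ¬ neumaierGraph.Adj 0 6 := by decide +kernel
  have h2 : ¬ neumaierGraph.Adj 0 7 := by decide +kernel
  have h3 : Fintype.card (neumaierGraph.commonNeighbors 0 6) = 8 := by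
    rw [neumaierGraph_card_common]
    decide +kernel
  have h4 : Fintype.card (neumaierGraph.commonNeighbors 0 7) = 4 := by
    rw [neumaierGraph_card_common]
    decide +kernel
  have h5 := h.of_not_adj (show (0 : Fin 16) ≠ 6 by decide) h1
  have h6 := h.of_not_adj (show (0 : Fin 16) ≠ 7 by decide) h2
  omega

theorem neumaierGraph_isNeumaierWith : neumaierGraph.IsNeumaierWith 16 9 4 2 4 where
  not_complete := neumaierGraph_ne_top
  edgeRegular := neumaierGraph_isEdgeRegularWith
  two_le := by norm_num
  exists_clique := ⟨_, rfl, neumaierGraph_isRegularClique⟩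

theorem neumaierGraph_isStrictlyNeumaier : neumaierGraph.IsStrictlyNeumaier :=
  ⟨⟨neumaierGraph_ne_top, ⟨_, _, _, neumaierGraph_isEdgeRegularWith⟩,
    ⟨_, _, neumaierGraph_isRegularClique⟩⟩, neumaierGraph_not_isStronglyRegular⟩

/-- Distinct vertices have distinct neighbourhoods, so a map that preserves and reflects adjacency
is injective; relabellings need not be checked to be permutations. -/
theorem neumaierGraph_adj_injective : ∀ i j : Fin 16,
    (∀ l, neumaierGraph.Adj i l ↔ neumaierGraph.Adj j l) → i = j := by
  decide +kernel

theorem RowSearch.relabel_lt (r : ℕ) (w : ℕ → Bool) {i : ℕ} : i < 16 → relabel r w i < 16 := by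
  intro _
  rw [relabel]
  split_ifs
  · omega
  · omega
  · have h1 : (w ((i - 4) / 2)).toNat < 2 := Bool.toNat_lt _
    have h2 : (i - 4) % 2 < 2 := Nat.mod_lt _ (by norm_num)
    have h3 : (i - 4) % 2 ^^^ (w ((i - 4) / 2)).toNat < 2 ^ 1 := Nat.xor_lt_two_pow h2 h1
    omega

variable {V : Type*} [Fintype V] [DecidableEq V] {G : SimpleGraph V} [DecidableRel G.Adj]
  {S : Finset V}

theorem IsCliqueLabelling.exists_of_card_eq_two [Nonempty V] (hS4 : #S = 4)
    (h2 : ∀ a ∈ S, ∀ b ∈ S, a ≠ b → #(traceClass G S a b) = 2) :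
    ∃ f, IsCliqueLabelling G S 2 f := by
  obtain ⟨s, hmem, hinj⟩ := exists_enumeration hS4
  have hp : ∀ c, ∃ p : ℕ → V, c < 6 →
      (∀ q < 2, p q ∈ traceClass G S (s (pairOf c).1) (s (pairOf c).2)) ∧
      ∀ q < 2, ∀ q' < 2, p q = p q' → q = q' := fun c => by
    by_cases hc : c < 6
    · obtain ⟨h3, h4, h5⟩ := pairOf_lt c hc
      obtain ⟨p, hp⟩ := exists_enumeration (h2 _ (hmem _ h3) _ (hmem _ h4) fun e =>
        h5 (hinj _ h3 _ h4 e))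
      exact ⟨p, fun _ => hp⟩
    · exact ⟨fun _ => Classical.arbitrary V, fun h => absurd h hc⟩
  choose p hp using hp
  have hf : ∀ c q, q < 2 → (if 4 + 2 * c + q < 4 then s (4 + 2 * c + q) else
      p ((4 + 2 * c + q - 4) / 2) ((4 + 2 * c + q - 4) % 2)) = p c q := fun c q hq => by
    rw [if_neg (by omega), show (4 + 2 * c + q - 4) / 2 = c by omega,
      show (4 + 2 * c + q - 4) % 2 = q by omega]
  refine ⟨fun i => if i < 4 then s i else p ((i - 4) / 2) ((i - 4) % 2), fun i hi => ?_,
    fun i hi j hj => ?_, fun c hc q hq => ?_, fun c hc q hq q' hq' => ?_⟩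
  · simpa only [hi, if_true] using hmem i hi
  · simpa only [hi, hj, if_true] using hinj i hi j hj
  · obtain ⟨h3, h4, -⟩ := pairOf_lt c hc
    simpa only [h3, h4, if_true, hf c q hq] using (hp c hc).1 q hq
  · simpa only [hf c q hq, hf c q' hq'] using (hp c hc).2 q hq q' hq'

omit [DecidableEq V] in
theorem nonempty_iso_of_isNeumaierRows (hn : Fintype.card V = 16) {f : ℕ → V} {g : ℕ → ℕ}
    (hg : ∀ i < 16, g i < 16) (h : isNeumaierRows (adjRow G f 16) g = true) :
    Nonempty (G ≃g neumaierGraph) := by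
  have hadj : ∀ i j : Fin 16, G.Adj (f (g i)) (f (g j)) ↔ neumaierGraph.Adj i j := fun i j => by
    have h1 := List.all_eq_true.1 (List.all_eq_true.1 h i (List.mem_range.2 i.2)) j
      (List.mem_range.2 j.2)
    rw [beq_iff_eq, testBit_adjRow (hg j j.2)] at h1
    change _ ↔ (neumaierRow i).testBit j = true
    rw [← h1, decide_eq_true_eq]
  have hinj : Function.Injective fun i : Fin 16 => f (g i) := fun i j e =>
    neumaierGraph_adj_injective i j fun l => by
      rw [← hadj, ← hadj, show f (g i) = f (g j) from e]
  have hbij := (Fintype.bijective_iff_injective_and_card _).2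
    ⟨hinj, by rw [Fintype.card_fin, hn]⟩
  exact ⟨(RelIso.mk (Equiv.ofBijective _ hbij) (hadj _ _) : neumaierGraph ≃g G).symm⟩

/-- A graph with parameters `(16, 9, 4; 2, 4)` that is not strongly regular is isomorphic to
`neumaierGraph`. -/
theorem nonempty_iso_neumaierGraph (hG : G.IsEdgeRegularWith 16 9 4) (hne : G ≠ ⊤)
    (hS : G.IsRegularClique 2 S) (hS4 : #S = 4) (hsrg : ¬ G.IsStronglyRegular) :
    Nonempty (G ≃g neumaierGraph) := by
  have : Nonempty V := Fintype.card_pos_iff.1 (by rw [hG.card]; norm_num)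
  obtain ⟨f, hf⟩ := IsCliqueLabelling.exists_of_card_eq_two (G := G) hS4 fun a ha b hb hab =>
    card_traceClass hG hS (by rw [hS4]) ha hb hab
  have hinj : Set.InjOn f (range 16) := hf.injOn hS
  have hdom : InDomains 16 (adjRow G f 16) domains16 := by
    intro x hx
    obtain ⟨i, hi, rfl⟩ := List.mem_map.1 hx
    rw [List.mem_range] at hi
    exact ⟨hi, adjRow_mem_rowsOf hG hinj fun j hj c hc => hf.adj_of_knownClique hS hi hj hc⟩
  obtain ⟨asg, h, hasg⟩ := of_search (isRowSystem_adjRow hG hinj (by norm_num)) _ _ _ [] hdom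
    (by simp) search_domains16
  rw [isSolution, Bool.and_eq_true, Bool.or_eq_true] at h
  obtain ⟨h1, h2⟩ := h
  -- `of_search` does not say that all rows are assigned; `isSolution` tests this itself.
  have hrow : ∀ i < 16, lookupRow asg i = adjRow G f 16 i := fun i hi => by
    obtain ⟨v, hv⟩ := Option.isSome_iff_exists.1 (List.all_eq_true.1 h1 i (List.mem_range.2 hi))
    obtain ⟨l₁, l₂, e, -⟩ := List.lookup_eq_some_iff.1 hv
    rw [lookupRow, hv, hasg (i, v) (by rw [e]; simp)]
    rfl
  rcases h2 with h2 | h2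
  -- These solutions have constant `μ = 6`, against the assumption.
  · refine absurd (hG.isStronglyRegular hne 6 fun x y hxy hadj => ?_) hsrg
    have hx : x ∈ (range 16).image f := by
      rw [image_range_eq_univ hinj hG.card]
      exact Finset.mem_univ x
    have hy : y ∈ (range 16).image f := by
      rw [image_range_eq_univ hinj hG.card]
      exact Finset.mem_univ y
    obtain ⟨i, hi, rfl⟩ := Finset.mem_image.1 hx
    obtain ⟨j, hj, rfl⟩ := Finset.mem_image.1 hy
    rw [Finset.mem_range] at hi hj
    have h3 := List.all_eq_true.1 (List.all_eq_true.1 h2 i (List.mem_range.2 hi)) j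
      (List.mem_range.2 hj)
    rw [hrow i hi, hrow j hj, testBit_adjRow hj, Bool.or_eq_true, Bool.or_eq_true, Nat.beq_eq,
      Nat.beq_eq, decide_eq_true_eq] at h3
    rcases h3 with (rfl | h3) | h3
    · exact absurd rfl hxy
    · exact absurd h3 hadj
    · rw [← popcount_adjRow hG.card hinj (by norm_num)]
      exact h3
  · simp only [existsNeumaierRows, List.any_eq_true] at h2
    obtain ⟨k, -, a, -, b, -, c, -, d, -, h3⟩ := h2
    refine nonempty_iso_of_isNeumaierRows hG.card (fun i hi => relabel_lt k _ hi) ?_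
      (g := relabel k (exchange a b c d)) (f := f)
    rw [isNeumaierRows, List.all_eq_true] at h3 ⊢
    intro i hi
    have h4 := h3 i hi
    rwa [hrow _ (relabel_lt k _ (List.mem_range.1 hi))] at h4

end SimpleGraph

/-! ### Conclusion. -/

namespace SimpleGraph

variable {V : Type*} [Fintype V] [DecidableEq V] {G : SimpleGraph V} [DecidableRel G.Adj]
  {n k ℓ m s : ℕ} {S : Finset V}

theorem parameters_of_card_le (hG : G.IsEdgeRegularWith n k ℓ) (hne : G ≠ ⊤)
    (hS : G.IsRegularClique m S) (hsrg : ¬ G.IsStronglyRegular) (hn : n ≤ 24) :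
    (n, k, ℓ, m, #S) = (16, 9, 4, 2, 4) ∨ (n, k, ℓ, m, #S) = (24, 8, 2, 1, 4) := by
  rcases parameters_of_not_isStronglyRegular hG hne hS hsrg hn with h | h | h
  · exact Or.inl h
  · simp only [Prod.mk.injEq] at h
    obtain ⟨rfl, rfl, rfl, rfl, h⟩ := h
    exact (not_isRegularClique_of_card_eq_22 hG hS h).elim
  · exact Or.inr h

theorem IsNeumaierWith.parameters (h : G.IsNeumaierWith n k ℓ m s) (hsrg : ¬ G.IsStronglyRegular)
    (hn : n ≤ 24) : (n, k, ℓ, m, s) = (16, 9, 4, 2, 4) ∨ (n, k, ℓ, m, s) = (24, 8, 2, 1, 4) := by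
  obtain ⟨S, rfl, hS⟩ := h.exists_clique
  exact parameters_of_card_le h.edgeRegular h.not_complete hS hsrg hn

end SimpleGraph

theorem mainTheorem6 :
    -- exactly one strictly Neumaier graph in NG(16,9,4;2,4), up to isomorphism
    (∃ (Γ : SimpleGraph (Fin 16)) (_ : DecidableRel Γ.Adj),
      Γ.IsStrictlyNeumaier ∧ Γ.IsNeumaierWith 16 9 4 2 4 ∧
      ∀ (V : Type u) [Fintype V] [DecidableEq V] (G : SimpleGraph V) [DecidableRel G.Adj],
        G.IsStrictlyNeumaier → G.IsNeumaierWith 16 9 4 2 4 → Nonempty (G ≃g Γ)) ∧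
    -- no strictly Neumaier graphs with parameters (21,14,9;4,7) or (22,12,5;2,4)
    (∀ (V : Type u) [Fintype V] [DecidableEq V] (G : SimpleGraph V) [DecidableRel G.Adj],
      G.IsStrictlyNeumaier →
        ¬ G.IsNeumaierWith 21 14 9 4 7 ∧ ¬ G.IsNeumaierWith 22 12 5 2 4) ∧
    -- the parameters of a strictly Neumaier graph on at most 24 vertices
    (∀ (V : Type u) [Fintype V] [DecidableEq V] (G : SimpleGraph V) [DecidableRel G.Adj],
      G.IsStrictlyNeumaier → Fintype.card V ≤ 24 →
        (G.IsNeumaierWith 16 9 4 2 4 ∨ G.IsNeumaierWith 24 8 2 1 4) ∧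
        ∀ n k ℓ m s : ℕ, G.IsNeumaierWith n k ℓ m s →
          (n, k, ℓ, m, s) = (16, 9, 4, 2, 4) ∨ (n, k, ℓ, m, s) = (24, 8, 2, 1, 4)) := by
  refine ⟨⟨SimpleGraph.neumaierGraph, inferInstance, SimpleGraph.neumaierGraph_isStrictlyNeumaier,
    SimpleGraph.neumaierGraph_isNeumaierWith, fun V _ _ G _ hG h => ?_⟩, fun V _ _ G _ hG => ⟨fun h => ?_,
    fun h => ?_⟩, fun V _ _ G _ hG hV => ⟨?_, fun n k ℓ m s h => ?_⟩⟩
  · obtain ⟨S, hS4, hS⟩ := h.exists_clique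
    exact SimpleGraph.nonempty_iso_neumaierGraph h.edgeRegular h.not_complete hS hS4 hG.2
  · simpa using h.parameters hG.2 (by norm_num)
  · simpa using h.parameters hG.2 (by norm_num)
  · obtain ⟨⟨hne, ⟨n, k, ℓ, he⟩, m, S, hS⟩, hsrg⟩ := hG
    have hn : n ≤ 24 := he.card ▸ hV
    rcases SimpleGraph.parameters_of_card_le he hne hS hsrg hn with h | h <;>
      simp only [Prod.mk.injEq] at h <;> obtain ⟨rfl, rfl, rfl, rfl, h⟩ := h
    · exact Or.inl ⟨hne, he, by norm_num, S, h, hS⟩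
    · exact Or.inr ⟨hne, he, by norm_num, S, h, hS⟩
  · exact h.parameters hG.2 (h.edgeRegular.card ▸ hV)
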